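/- **Setting.** Let $b$ be a prime, and write $n(x)=n_0+n_1x+\cdots+n_ax^a\in\mathbb F_b[x]$ for $n\in\mathbb N_0$ with base $b$ expansion $n=n_0+n_1b+\cdots+n_ab^a$. For $k=\kappa_0+\kappa_1b+\cdots+\kappa_{a-1}b^{a-1}\in\mathbb N_0$ and $x=\xi_1b^{-1}+\xi_2b^{-2}+\cdots\in[0,1)$ (infinitely many $\xi_i\ne b-1$) let $\mathrm{wal}_k(x)=e^{2\pi i(\kappa_0\xi_1+\cdots+\kappa_{a-1}\xi_a)/b}$; for $\boldsymbol k\in\mathbb N_0^d$ let $\mathrm{wal}_{\boldsymbol k}(\boldsymbol x)=\prod_{j=1}^d\mathrm{wal}_{k_j}(x_j)$ and $\hat f(\boldsymbol k)=\int_{[0,1]^d}f\,\overline{\mathrm{wal}_{\boldsymbol k}}$. For $\alpha>1$ and positive reals $\boldsymbol\gamma=(\gamma_j)_{j\ge1}$ let $r_\alpha(0)=1$, $r_\alpha(k)=b^{\alpha\lfloor\log_bk\rfloor}$ for $k\ge1$, and $$r_{\alpha,\boldsymbol\gamma}(\boldsymbol k)=\Big(\prod_{j:\,k_j\neq0}\gamma_j\Big)^{-1}\prod_{j=1}^dr_\alpha(k_j),\qquad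 \|f\|_{W^\alpha_{d,\boldsymbol\gamma}}=\sup_{\boldsymbol k\in\mathbb N_0^d}|\hat f(\boldsymbol k)|\,r_{\alpha,\boldsymbol\gamma}(\boldsymbol k).$$ The weighted Walsh space $W^\alpha_{d,\boldsymbol\gamma}$ consists of the complex-valued $f\in L^2([0,1]^d)$ of finite norm that equal their (absolutely convergent) Walsh series $\sum_{\boldsymbol k}\hat f(\boldsymbol k)\,\mathrm{wal}_{\boldsymbol k}$ at every point of $[0,1)^d$. For $t\in\mathbb N$ let $v_t:\mathbb F_b((x^{-1}))\to[0,1)$, $v_t\big(\sum_{\ell\ge w}c_\ell x^{-\ell}\big)=\sum_{\ell=\max(1,w)}^tc_\ell b^{-\ell}$. For $\boldsymbol g\in(\mathbb F_b[x])^d$ and $N=b^m$ let $$\boldsymbol x_n=\Big(v_m\Big(\frac{n(x)g_1(x)}{x^m}\Big),\dots,v_m\Big(\frac{n(x)g_d(x)}{x^m}\Big)\Big),\qquad 0\le n<N,$$ be the polynomial lattice with generating vector $\boldsymbol g$ and modulus $x^m$, and let $$e_{N,d,\alpha,\boldsymbol\gamma}(\boldsymbol g)=\sup_{\|f\|_{W^\alpha_{d,\boldsymbol\gamma}}\le1}\Big|\int_{[0,1]^d}f-\frac1N\sum_{n=0}^{N-1}f(\boldsymbol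 x_n)\Big|$$ be the worst-case error of the corresponding polynomial lattice rule. **The CBC-DBD algorithm** with positive weights $\boldsymbol\eta=(\eta_j)_{j\ge1}$. Put $g_1=1$. For $r=2,\dots,d$ start with $g_{r,1}=1$; for $w=2,\dots,m$ put $g_{r,w}=g_{r,w-1}+g^*x^{w-1}$, where $g^*\in\mathbb F_b$ minimizes $g\mapsto h_{r,w}(g_{r,w-1}+g\,x^{w-1})$ over $\mathbb F_b$ (ties broken arbitrarily); finally $g_r=g_{r,m}$. Here, with $\Lambda_t(q)=\lfloor\log_b v_t(q(x)/x^t)\rfloor+1$, $$h_{r,w}(q)=\sum_{t=w}^m\frac1{b^{t-w}}\sum_{\substack{\ell=1\\ b\nmid\ell}}^{b^t-1}\big(1+\eta_r(1-b)\Lambda_w(\ell(x)q(x))\big)\prod_{j=1}^{r-1}\big(1+\eta_j(1-b)\Lambda_t(\ell(x)g_j(x))\big).$$ **Theorem.** Let $b$ be prime and let $\boldsymbol\gamma=(\gamma_j)_{j\ge1}$ be a sequence of positive reals. For $s>0$ write $\boldsymbol\gamma^s=(\gamma_j^s)_{j\ge1}$. 1. If $\sum_j\gamma_j<\infty$, then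 there are positive constants $C(\boldsymbol\gamma^\alpha)$ for $\alpha>1$, depending only on $b,\boldsymbol\gamma,\alpha$, and $\bar C(\boldsymbol\gamma,\delta)$ for $\delta>0$, depending only on $b,\boldsymbol\gamma,\delta$, such that for all integers $m\ge4$, $d\ge1$ and $N=b^m$, every generating vector $\boldsymbol g$ obtained by the CBC-DBD algorithm run with the weights $\boldsymbol\eta=\boldsymbol\gamma$ satisfies, for all $\delta>0$ and simultaneously for all $\alpha>1$, $$e_{N,d,\alpha,\boldsymbol\gamma^\alpha}(\boldsymbol g)\le\frac1{N^\alpha}\Big(C(\boldsymbol\gamma^\alpha)+\bar C(\boldsymbol\gamma,\delta)\,N^{\alpha\delta}\Big).$$ 2. There is a positive constant $K(\boldsymbol\gamma)$, depending only on $b,\boldsymbol\gamma$, such that for every $\alpha>1$ with $\sum_j\gamma_j^{1/\alpha}<\infty$ there are positive constants $\bar K(\boldsymbol\gamma^{1/\alpha},\delta)$ for $\delta>0$, depending only on $b,\boldsymbol\gamma,\alpha,\delta$, such that for all integers $m\ge4$, $d\ge1$ and $N=b^m$, every generating vector $\widetilde{\boldsymbol g}$ obtained by the CBC-DBD algorithm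 run with the weights $\boldsymbol\eta=\boldsymbol\gamma^{1/\alpha}$ satisfies, for all $\delta>0$, $$e_{N,d,\alpha,\boldsymbol\gamma}(\widetilde{\boldsymbol g})\le\frac1{N^\alpha}\Big(K(\boldsymbol\gamma)+\bar K(\boldsymbol\gamma^{1/\alpha},\delta)\,N^{\alpha\delta}\Big).$$ In particular, all constants are independent of $d$ and $N$. -/

import Mathlib

/-! Worst-case integration error of polynomial lattice rules in weighted Walsh spaces, and the
component-by-component digit-by-digit construction of their generating vectors.

Coordinates and weights are indexed from `0`: the coordinates are `j : Fin d`, and `γ j` is the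
weight of coordinate `j` (it is `γ_{j+1}` when coordinates are numbered from `1`). -/

noncomputable section

namespace WalshPLR

open MeasureTheory Polynomial
open scoped ENNReal

/-! ### Walsh functions and weighted Walsh spaces -/

/-- The `k`-th Walsh function in base `b`: `exp (2πi (κ₀ ξ₁ + κ₁ ξ₂ + ⋯) / b)`, where the `κᵢ` are
the base `b` digits of `k`, and the `ξᵢ` those of `x ∈ [0,1)` in the expansion in which infinitely
many digits differ from `b - 1`, that is `ξ_{i+1} = ⌊x b^{i+1}⌋ mod b`. -/
def wal (b k : ℕ) (x : ℝ) : ℂ :=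
  Complex.exp (2 * Real.pi * Complex.I *
    ((∑ i ∈ Finset.range (Nat.log b k + 1),
      (k / b ^ i % b) * (⌊x * (b : ℝ) ^ (i + 1)⌋₊ % b) : ℕ) : ℂ) / (b : ℂ))

/-- The `d`-variate Walsh function. -/
def walVec (b : ℕ) {d : ℕ} (k : Fin d → ℕ) (x : Fin d → ℝ) : ℂ :=
  ∏ j, wal b (k j) (x j)

/-- The integral of `f` over the unit cube `[0,1]^d`. -/
def cubeIntegral {d : ℕ} (f : (Fin d → ℝ) → ℂ) : ℂ :=
  ∫ x in Set.Icc (0 : Fin d → ℝ) 1, f x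

/-- The `k`-th Walsh coefficient of `f`. -/
def walshCoeff (b : ℕ) {d : ℕ} (f : (Fin d → ℝ) → ℂ) (k : Fin d → ℕ) : ℂ :=
  cubeIntegral fun x => f x * (starRingEnd ℂ) (walVec b k x)

/-- The decay function `r_α`: `r_α(0) = 1` and `r_α(k) = b^{α ⌊log_b k⌋}` for `k ≠ 0`. -/
def decay (b : ℕ) (α : ℝ) (k : ℕ) : ℝ :=
  if k = 0 then 1 else (b : ℝ) ^ (α * (Nat.log b k : ℝ))

/-- The weighted decay function `r_{α,γ}(k) = γ_{supp k}⁻¹ ∏_j r_α(k_j)` for product weights. -/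
def weightedDecay (b : ℕ) (α : ℝ) (γ : ℕ → ℝ) {d : ℕ} (k : Fin d → ℕ) : ℝ :=
  (∏ j ∈ Finset.univ.filter (fun j => k j ≠ 0), γ j)⁻¹ * ∏ j, decay b α (k j)

/-- The norm `sup_k |f̂(k)| r_{α,γ}(k)`, with value `∞` if the supremum is not finite. -/
def walshNorm (b : ℕ) (α : ℝ) (γ : ℕ → ℝ) {d : ℕ} (f : (Fin d → ℝ) → ℂ) : ℝ≥0∞ :=
  ⨆ k : Fin d → ℕ, ‖walshCoeff b f k‖ₑ * ENNReal.ofReal (weightedDecay b α γ k)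

/-- The weighted Walsh space: the square-integrable functions on the unit cube that are given by
their Walsh series at each point of `[0,1)^d` and whose norm is finite. -/
def walshSpace (b d : ℕ) (α : ℝ) (γ : ℕ → ℝ) : Set ((Fin d → ℝ) → ℂ) :=
  {f | MemLp f 2 (volume.restrict (Set.Icc (0 : Fin d → ℝ) 1)) ∧
    (∀ x : Fin d → ℝ, (∀ j, x j ∈ Set.Ico (0 : ℝ) 1) →
      HasSum (fun k : Fin d → ℕ => walshCoeff b f k * walVec b k x) (f x)) ∧
    walshNorm b α γ f < ∞}

/-- The equal-weight quadrature rule with nodes `P 0, …, P (N - 1)`. -/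
def qmcRule {d : ℕ} (N : ℕ) (P : ℕ → Fin d → ℝ) (f : (Fin d → ℝ) → ℂ) : ℂ :=
  1 / (N : ℂ) * ∑ n ∈ Finset.range N, f (P n)

/-- The worst-case error, over the unit ball of the weighted Walsh space, of the equal-weight
quadrature rule with nodes `P 0, …, P (N - 1)`; a supremum in `[0,∞]`. -/
def worstCaseError (b d : ℕ) (α : ℝ) (γ : ℕ → ℝ) (N : ℕ) (P : ℕ → Fin d → ℝ) : ℝ≥0∞ :=
  ⨆ f ∈ {f | f ∈ walshSpace b d α γ ∧ walshNorm b α γ f ≤ 1},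
    ‖cubeIntegral f - qmcRule N P f‖ₑ

/-! ### Polynomial lattices -/

/-- The polynomial `n(x) = n₀ + n₁ x + ⋯` whose coefficients are the base `b` digits of `n`. -/
def natPoly (b n : ℕ) : (ZMod b)[X] :=
  ∑ i ∈ Finset.range (Nat.log b n + 1), C ((n / b ^ i % b : ℕ) : ZMod b) * X ^ i

/-- The field `𝔽_b((x⁻¹))`, as the Laurent series over `𝔽_b` in the variable `x⁻¹`: the
coefficient of `x^{-ℓ}` is the coefficient of index `ℓ`. -/
abbrev LaurentInv (b : ℕ) : Type := LaurentSeries (ZMod b)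

/-- The embedding of `𝔽_b[x]` into `𝔽_b((x⁻¹))`, which sends `x` to the series of index `-1`. -/
def toLaurentInv (b : ℕ) (q : (ZMod b)[X]) : LaurentInv b :=
  q.eval₂ HahnSeries.C (HahnSeries.single (-1 : ℤ) (1 : ZMod b))

/-- The map `v_m`, which sends `∑ t_ℓ x^{-ℓ}` to `∑_{1 ≤ ℓ ≤ m} t_ℓ b^{-ℓ}`. -/
def vMap (b m : ℕ) (L : LaurentInv b) : ℝ :=
  ∑ l ∈ Finset.Icc 1 m, ((L.coeff (l : ℤ)).val : ℝ) / (b : ℝ) ^ l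

/-- The number `v_m (q / p)` for polynomials `q` and `p`. -/
def vFrac (b m : ℕ) [Fact b.Prime] (q p : (ZMod b)[X]) : ℝ :=
  vMap b m (toLaurentInv b q / toLaurentInv b p)

/-- The `n`-th point of the polynomial lattice with generating vector `g` and modulus `p`, where
`p` has degree `m` and `n` runs through `0, …, b^m - 1`. -/
def latticePoint (b m : ℕ) [Fact b.Prime] {d : ℕ} (g : Fin d → (ZMod b)[X]) (p : (ZMod b)[X])
    (n : ℕ) : Fin d → ℝ :=
  fun j => vFrac b m (natPoly b n * g j) p

/-- The worst-case error of the polynomial lattice rule with generating vector `g` and modulus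
`x^m`, which has `b^m` points. -/
def latticeError (b m d : ℕ) [Fact b.Prime] (α : ℝ) (γ : ℕ → ℝ) (g : Fin d → (ZMod b)[X]) :
    ℝ≥0∞ :=
  worstCaseError b d α γ (b ^ m) (latticePoint b m g (X ^ m))

/-! ### The component-by-component digit-by-digit algorithm -/

/-- The factor `1 + c (1 - b) (⌊log_b (v_t (q / x^t))⌋ + 1)`. -/
def qualityFactor (b t : ℕ) [Fact b.Prime] (c : ℝ) (q : (ZMod b)[X]) : ℝ :=
  1 + c * (1 - (b : ℝ)) * ((⌊Real.logb b (vFrac b t q (X ^ t))⌋ : ℝ) + 1)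

/-- The digit-wise quality function for the coefficient of `x^{w-1}` of component `r`. It depends
only on those components `g j` of `g` with `j < r`. -/
def digitQuality (b m : ℕ) [Fact b.Prime] (η : ℕ → ℝ) {d : ℕ} (g : Fin d → (ZMod b)[X])
    (r : Fin d) (w : ℕ) (q : (ZMod b)[X]) : ℝ :=
  ∑ t ∈ Finset.Icc w m, 1 / (b : ℝ) ^ (t - w) *
    ∑ l ∈ (Finset.Icc 1 (b ^ t - 1)).filter (fun l => ¬ b ∣ l),
      qualityFactor b w (η r) (natPoly b l * q) *
        ∏ j ∈ Finset.Iio r, qualityFactor b t (η j) (natPoly b l * g j)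

/-- `g` is a generating vector returned by the algorithm run with the weights `η`, for some way of
breaking ties between minimizers. Here `G r w` is the state `g_{r,w}` of component `r` after the
coefficients of `1, x, …, x^{w-1}` have been fixed. The first component is the polynomial `1`;
each further component starts from `1`, and its coefficients of `x, …, x^{m-1}` are chosen
successively, each as a minimizer of the digit-wise quality function. -/
def IsCBCDBDOutput (b m d : ℕ) [Fact b.Prime] (η : ℕ → ℝ) (g : Fin d → (ZMod b)[X]) : Prop :=
  ∃ G : Fin d → ℕ → (ZMod b)[X],
    (∀ r : Fin d, (r : ℕ) = 0 → G r m = 1) ∧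
    (∀ r : Fin d, 0 < (r : ℕ) → G r 1 = 1) ∧
    (∀ r : Fin d, 0 < (r : ℕ) → ∀ w ∈ Finset.Icc 2 m, ∃ c : ZMod b,
      (∀ c' : ZMod b,
        digitQuality b m η g r w (G r (w - 1) + C c * X ^ (w - 1)) ≤
          digitQuality b m η g r w (G r (w - 1) + C c' * X ^ (w - 1))) ∧
      G r w = G r (w - 1) + C c * X ^ (w - 1)) ∧
    ∀ r : Fin d, g r = G r m

end WalshPLR

end

noncomputable section

namespace WalshPLR

open MeasureTheory Polynomial
open scoped ENNReal

set_option linter.unusedSectionVars false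

/-! ### Base `b` digits and the associated polynomials -/

/-! At the points of a polynomial lattice the Walsh functions are additive characters (`wal_radix`).
Averaging a Walsh series over the points therefore keeps exactly the frequencies k with x^m ∣ k·g,
and the worst-case error is at most the sum of 1/r(k) over the nonzero such k
(`latticeError_le_tsum`). Put N = b^m.

Frequencies with some component at least N contribute O(N^(-α)): every g_j has constant coefficient
1, so the low m digits of the large component are determined by the other components
(`tsum_coordWeight_large_le`).

For the remaining finite box, both parts use space weights η^α, where η are the weights of the
algorithm. As a sum of α-th powers is at most the α-th power of the sum, only the figure of merit
with exponent 1 matters. By character sums it is at most the mean over n of ∏(1 + η_j L(n g_j))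
minus ∏(1 + η_j), where L, linear in the number of leading zero digits, is `leadWeight`. Comparing
each minimizing digit with the average over all digits shows that the terms n ≠ 0 sum to at most N
∏(1 + η_j) (`sum_leadWeight_le_of_minimizing`, `meritSum_le`). This cancels the subtracted product,
leaving the term n = 0, at most ∏(1 + b η_j m)/N. Summability of η makes it O(N^(δ-1)) uniformly in
d, because m is logarithmic in N (`exists_prod_one_add_mul_le`).

The box thus contributes N^(-α) (c_δ N^δ)^α. For part 1 the factor c_δ^α, which mixes α and δ, still
has to be split into a constant in α and a constant in δ. -/

lemma sum_range_mul_eq {M : Type*} [AddCommMonoid M] (f : ℕ → M) (a c : ℕ) :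
    ∑ n ∈ Finset.range (a * c), f n =
      ∑ j ∈ Finset.range c, ∑ i ∈ Finset.range a, f (i + a * j) := by
  induction c with
  | zero => simp
  | succ c ih =>
    rw [Nat.mul_succ, Finset.sum_range_add, ih, Finset.sum_range_succ]
    simp_rw [add_comm]

lemma sum_range_natCast_zmod {M : Type*} [AddCommMonoid M] (b : ℕ) [NeZero b] (f : ZMod b → M) :
    ∑ n ∈ Finset.range b, f (n : ZMod b) = ∑ c : ZMod b, f c := by
  refine Finset.sum_nbij' (fun n => (n : ZMod b)) ZMod.val ?_ ?_ ?_ ?_ ?_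
  · simp
  · intro c _; simpa using ZMod.val_lt c
  · intro n hn; exact ZMod.val_cast_of_lt (by simpa using hn)
  · intro c _; simp
  · simp

lemma sum_Icc_one_eq_sum_range {M : Type*} [AddCommMonoid M] (f : ℕ → M) (t : ℕ) :
    ∑ l ∈ Finset.Icc 1 t, f l = ∑ i ∈ Finset.range t, f (i + 1) := by
  induction t with
  | zero => simp
  | succ t ih => rw [Finset.sum_Icc_succ_top (by omega), ih, Finset.sum_range_succ]

variable {b : ℕ}

lemma coeff_natPoly (hb : 1 < b) (n i : ℕ) :
    (natPoly b n).coeff i = ((n / b ^ i : ℕ) : ZMod b) := by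
  simp only [natPoly, finsetSum_coeff, coeff_C_mul_X_pow]
  rw [Finset.sum_ite_eq]
  split_ifs with h
  · simp
  · have : n < b ^ i := Nat.lt_pow_of_log_lt hb (by simpa using h)
    simp [Nat.div_eq_of_lt this]

lemma natPoly_zero (hb : 1 < b) : natPoly b 0 = 0 := by
  ext i; simp [coeff_natPoly hb]

lemma natPoly_of_lt (hb : 1 < b) {k : ℕ} (hk : k < b) : natPoly b k = C (k : ZMod b) := by
  ext i
  rw [coeff_natPoly hb, coeff_C]
  split_ifs with h
  · simp [h]
  · rw [Nat.div_eq_of_lt (hk.trans_le (Nat.le_self_pow h b))]; simp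

lemma natPoly_add_pow_mul (hb : 1 < b) {h m : ℕ} (hh : h < b ^ m) (k : ℕ) :
    natPoly b (h + b ^ m * k) = natPoly b h + X ^ m * natPoly b k := by
  have hb0 : 0 < b := by omega
  ext i
  rw [coeff_add, coeff_X_pow_mul']
  simp only [coeff_natPoly hb]
  split_ifs with hi
  · obtain ⟨j, rfl⟩ := Nat.exists_eq_add_of_le hi
    have h1 : h / b ^ (m + j) = 0 :=
      Nat.div_eq_of_lt (hh.trans_le (Nat.pow_le_pow_right hb0 hi))
    have h2 : (h + b ^ m * k) / b ^ (m + j) = k / b ^ j := by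
      rw [pow_add, ← Nat.div_div_eq_div_mul, Nat.add_mul_div_left _ _ (pow_pos hb0 m),
        Nat.div_eq_of_lt hh, zero_add]
    rw [h1, h2]; simp
  · obtain ⟨j, rfl⟩ := Nat.exists_eq_add_of_lt (not_le.mp hi)
    have : h + b ^ (i + j + 1) * k = h + b ^ i * (b * (b ^ j * k)) := by ring
    rw [this, Nat.add_mul_div_left _ _ (pow_pos hb0 i)]
    simp

lemma natPoly_add_mul (hb : 1 < b) {h : ℕ} (hh : h < b) (k : ℕ) :
    natPoly b (h + b * k) = C (h : ZMod b) + X * natPoly b k := by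
  have := natPoly_add_pow_mul hb (h := h) (m := 1) (by simpa using hh) k
  simpa [natPoly_of_lt hb hh] using this

lemma natPoly_pow_mul (hb : 1 < b) (m k : ℕ) :
    natPoly b (b ^ m * k) = X ^ m * natPoly b k := by
  have := natPoly_add_pow_mul hb (h := 0) (m := m) (pow_pos (by omega) m) k
  simpa [natPoly_zero hb] using this

lemma coeff_zero_natPoly_ne_zero (hb : 1 < b) {l : ℕ} (hl : ¬ b ∣ l) :
    (natPoly b l).coeff 0 ≠ 0 := by
  rw [coeff_natPoly hb]
  simpa [ZMod.natCast_eq_zero_iff] using hl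

lemma eq_of_X_pow_dvd_natPoly_sub (hb : 1 < b) {m : ℕ} : ∀ {h h' : ℕ}, h < b ^ m → h' < b ^ m →
    X ^ m ∣ natPoly b h - natPoly b h' → h = h' := by
  have hb0 : 0 < b := by omega
  induction m with
  | zero => intro h h' h1 h2 _; simp at h1 h2; omega
  | succ m ih =>
    intro h h' h1 h2 hd
    rw [X_pow_dvd_iff] at hd
    have e1 : h / b = h' / b := by
      refine ih (Nat.div_lt_of_lt_mul (by rwa [pow_succ'] at h1))
        (Nat.div_lt_of_lt_mul (by rwa [pow_succ'] at h2)) (X_pow_dvd_iff.mpr fun i hi => ?_)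
      have := hd (i + 1) (by omega)
      simp only [coeff_sub, coeff_natPoly hb, pow_succ', ← Nat.div_div_eq_div_mul] at this ⊢
      exact this
    have e2 : h % b = h' % b := by
      have := hd 0 (by omega)
      simp only [coeff_sub, coeff_natPoly hb, pow_zero, Nat.div_one, sub_eq_zero] at this
      exact (ZMod.natCast_eq_natCast_iff _ _ _).mp this
    rw [← Nat.div_add_mod h b, ← Nat.div_add_mod h' b, e1, e2]

lemma log_add_mul (hb : 1 < b) {h : ℕ} (hh : h < b) {k : ℕ} (hk : k ≠ 0) :
    Nat.log b (h + b * k) = Nat.log b k + 1 := by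
  have h1 : (h + b * k) / b = k := by
    rw [Nat.add_mul_div_left _ _ (by omega), Nat.div_eq_of_lt hh, zero_add]
  have h2 := Nat.log_div_base b (h + b * k)
  have h3 : 0 < Nat.log b (h + b * k) := Nat.log_pos hb (by nlinarith [Nat.pos_of_ne_zero hk])
  rw [h1] at h2; omega

lemma log_add_pow_mul (hb : 1 < b) {h m : ℕ} (hh : h < b ^ m) {k : ℕ} (hk : k ≠ 0) :
    Nat.log b (h + b ^ m * k) = Nat.log b k + m := by
  induction m generalizing h with
  | zero => simp at hh; simp [hh]
  | succ m ih =>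
    have hlt : h / b < b ^ m := Nat.div_lt_of_lt_mul (by rwa [pow_succ'] at hh)
    have : h + b ^ (m + 1) * k = h % b + b * (h / b + b ^ m * k) := by
      conv_lhs => rw [← Nat.mod_add_div h b]
      ring
    have hpos : 0 < b ^ m * k := Nat.mul_pos (pow_pos (by omega) m) (Nat.pos_of_ne_zero hk)
    rw [this, log_add_mul hb (Nat.mod_lt _ (by omega))
      (Nat.add_pos_right _ hpos).ne', ih hlt, add_assoc]

/-! ### Digits of the points of a polynomial lattice -/

/-- The number `v_t (q / x^t)`, by recursion on `t`. -/
def radix (b : ℕ) : ℕ → (ZMod b)[X] → ℝ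
  | 0, _ => 0
  | t + 1, q => (((q.coeff t).val : ℝ) + radix b t q) / b

variable [Fact b.Prime]

lemma radix_nonneg (t : ℕ) (q : (ZMod b)[X]) : 0 ≤ radix b t q := by
  induction t with
  | zero => simp [radix]
  | succ t ih => rw [radix]; positivity

lemma radix_lt_one (t : ℕ) (q : (ZMod b)[X]) : radix b t q < 1 := by
  induction t with
  | zero => simp [radix]
  | succ t ih =>
    have hb : (0 : ℝ) < b := by exact_mod_cast (Fact.out : b.Prime).pos
    rw [radix, div_lt_one hb]
    have : ((q.coeff t).val : ℝ) + 1 ≤ b := by exact_mod_cast ZMod.val_lt (q.coeff t)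
    linarith

lemma radix_pos {t : ℕ} {q : (ZMod b)[X]} (hq : q.coeff 0 ≠ 0) : 0 < radix b (t + 1) q := by
  have hb : (0 : ℝ) < b := by exact_mod_cast (Fact.out : b.Prime).pos
  induction t with
  | zero =>
    have : 0 < (q.coeff 0).val := ZMod.val_pos.mpr hq
    simp only [radix, add_zero]; positivity
  | succ t ih => rw [radix]; positivity

lemma coeff_toLaurentInv (q : (ZMod b)[X]) (n : ℕ) :
    (toLaurentInv b q).coeff (-(n : ℤ)) = q.coeff n := by
  induction q using Polynomial.induction_on' with
  | add p q hp hq =>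
    simp only [toLaurentInv, eval₂_add] at *
    rw [HahnSeries.coeff_add, hp, hq, coeff_add]
  | monomial i a =>
    simp only [toLaurentInv, eval₂_monomial, HahnSeries.single_pow, one_pow, HahnSeries.C_apply,
      HahnSeries.single_mul_single, coeff_monomial, HahnSeries.coeff_single]
    simp [eq_comm]

lemma vFrac_eq_radix (t : ℕ) (q : (ZMod b)[X]) : vFrac b t q (X ^ t) = radix b t q := by
  have hX : (toLaurentInv b (X ^ t))⁻¹ = HahnSeries.single (t : ℤ) (1 : ZMod b) := by
    simp [toLaurentInv, HahnSeries.single_pow, HahnSeries.inv_single]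
  have hc : ∀ l ∈ Finset.Icc 1 t,
      ((toLaurentInv b q / toLaurentInv b (X ^ t)).coeff (l : ℤ)) = q.coeff (t - l) := by
    intro l hl
    have hl' : l ≤ t := (Finset.mem_Icc.mp hl).2
    have : (l : ℤ) = -((t - l : ℕ) : ℤ) + t := by push_cast [hl']; ring
    rw [div_eq_mul_inv, hX, this, HahnSeries.coeff_mul_single_add, coeff_toLaurentInv, mul_one]
  rw [vFrac, vMap, Finset.sum_congr rfl fun l hl => by rw [hc l hl]]
  clear hc hX
  induction t with
  | zero => simp [radix]
  | succ t ih =>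
    rw [sum_Icc_one_eq_sum_range] at ih ⊢
    rw [radix, ← ih, Finset.sum_range_succ', add_div, Finset.sum_div, add_comm]
    congr 1
    · simp
    · refine Finset.sum_congr rfl fun i _ => ?_
      rw [show t + 1 - (i + 1 + 1) = t - (i + 1) by omega, div_div, ← pow_succ]

lemma floor_radix_mul_pow_mod (t i : ℕ) (q : (ZMod b)[X]) :
    ⌊radix b t q * (b : ℝ) ^ (i + 1)⌋₊ % b = if i < t then (q.coeff (t - (i + 1))).val else 0 := by
  have hb : (b : ℝ) ≠ 0 := by exact_mod_cast (Fact.out : b.Prime).ne_zero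
  have hlt : ∀ a : ZMod b, a.val < b := ZMod.val_lt
  induction t generalizing i with
  | zero => simp [radix]
  | succ t ih =>
    have hr0 := radix_nonneg t q
    rw [radix, pow_succ', ← mul_assoc, div_mul_cancel₀ _ hb]
    cases i with
    | zero =>
      have : ⌊((q.coeff t).val : ℝ) + radix b t q⌋₊ = (q.coeff t).val := by
        rw [add_comm, Nat.floor_add_natCast hr0, Nat.floor_eq_zero.mpr (radix_lt_one t q), zero_add]
      rw [pow_zero, mul_one, this, Nat.mod_eq_of_lt (hlt _)]
      simp
    | succ i =>
      have : (((q.coeff t).val : ℝ) + radix b t q) * (b : ℝ) ^ (i + 1) =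
          radix b t q * (b : ℝ) ^ (i + 1) + ((b * ((q.coeff t).val * b ^ i) : ℕ) : ℝ) := by
        push_cast; ring
      rw [this, Nat.floor_add_natCast (by positivity), Nat.add_mul_mod_self_left, ih]
      simp only [add_lt_add_iff_right]
      rw [show t + 1 - (i + 1 + 1) = t - (i + 1) by omega]

/-- The Walsh functions at the points of a polynomial lattice are additive characters. -/
lemma wal_radix (k t : ℕ) (q : (ZMod b)[X]) :
    wal b k (radix b t q) = ZMod.stdAddChar ((X * (natPoly b k * q)).coeff t) := by
  have key : (X * (natPoly b k * q)).coeff t = ((∑ i ∈ Finset.range (Nat.log b k + 1),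
      (k / b ^ i % b) * (⌊radix b t q * (b : ℝ) ^ (i + 1)⌋₊ % b) : ℕ) : ZMod b) := by
    rw [natPoly, Finset.sum_mul, Finset.mul_sum, finsetSum_coeff, Nat.cast_sum]
    refine Finset.sum_congr rfl fun i _ => ?_
    rw [show X * (C ((k / b ^ i % b : ℕ) : ZMod b) * X ^ i * q) =
      C ((k / b ^ i % b : ℕ) : ZMod b) * (X ^ (i + 1) * q) by ring, coeff_C_mul, coeff_X_pow_mul']
    have h := floor_radix_mul_pow_mod t i q
    have h' := congrArg (Nat.cast : ℕ → ZMod b) h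
    simp only [Nat.cast_mul, ZMod.natCast_mod] at h' ⊢
    rw [h']
    simp only [Order.add_one_le_iff]
    split_ifs <;> simp
  rw [key, ← Int.cast_natCast, ZMod.stdAddChar_coe, wal, Int.cast_natCast]

/-! ### The number of leading zero digits -/

/-- The quantity `(1 - b) (⌊log_b (v_t (q / x^t))⌋ + 1)`, by recursion on `t`. -/
def leadWeight (b : ℕ) : ℕ → (ZMod b)[X] → ℝ
  -- If t ≥ 1 and the constant coefficient is nonzero, this base value never contributes. The value
  -- 1 is what makes the character expansion `sum_freqWeight_one_phase` valid for every q.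
  | 0, _ => 1
  | t + 1, q => if q.coeff t = 0 then (b - 1) + leadWeight b t q else 0

lemma leadWeight_nonneg (t : ℕ) (q : (ZMod b)[X]) : 0 ≤ leadWeight b t q := by
  have hb : (1 : ℝ) ≤ b := by exact_mod_cast (Fact.out : b.Prime).one_le
  induction t with
  | zero => simp [leadWeight]
  | succ t ih => rw [leadWeight]; split_ifs <;> linarith

lemma leadWeight_zero (t : ℕ) : leadWeight b t 0 = 1 + t * ((b : ℝ) - 1) := by
  induction t with
  | zero => simp [leadWeight]
  | succ t ih => simp [leadWeight, ih]; ring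

lemma leadWeight_congr {t : ℕ} {p q : (ZMod b)[X]} (h : ∀ i < t, p.coeff i = q.coeff i) :
    leadWeight b t p = leadWeight b t q := by
  induction t with
  | zero => rfl
  | succ t ih => rw [leadWeight, leadWeight, h t (by omega), ih fun i hi => h i (by omega)]

lemma leadWeight_one {q : (ZMod b)[X]} (hq : q.coeff 0 ≠ 0) : leadWeight b 1 q = 0 := by
  simp [leadWeight, hq]

lemma leadWeight_X_pow_mul {t : ℕ} (ht : 1 ≤ t) (s : ℕ) {q : (ZMod b)[X]} (hq : q.coeff 0 ≠ 0) :
    leadWeight b (t + s) (X ^ s * q) = leadWeight b t q := by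
  induction t, ht using Nat.le_induction with
  | base => rw [leadWeight_one hq, add_comm, leadWeight, coeff_X_pow_mul']; simp [hq]
  | succ t ht ih =>
    rw [show t + 1 + s = t + s + 1 by ring, leadWeight, leadWeight, ih, coeff_X_pow_mul']
    simp

lemma floor_logb_radix_of_ne_zero {t : ℕ} {q : (ZMod b)[X]} (hq : q.coeff t ≠ 0) :
    ⌊Real.logb b (radix b (t + 1) q)⌋ = -1 := by
  have hb : (1 : ℝ) < b := by exact_mod_cast (Fact.out : b.Prime).one_lt
  have hb0 : (0 : ℝ) < b := by linarith
  have h1 : (1 : ℝ) ≤ ((q.coeff t).val : ℝ) := by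
    exact_mod_cast ZMod.val_pos.mpr hq
  have h2 : (b : ℝ)⁻¹ ≤ radix b (t + 1) q := by
    rw [radix, inv_eq_one_div]
    have := radix_nonneg t q
    gcongr
    linarith
  have h3 : 0 < radix b (t + 1) q := (inv_pos.mpr hb0).trans_le h2
  rw [Int.floor_eq_iff]
  constructor
  · rw [Real.le_logb_iff_rpow_le hb h3]
    simpa [Real.rpow_neg_one] using h2
  · simpa using Real.logb_neg hb h3 (radix_lt_one _ _)

lemma qualityFactor_eq {t : ℕ} (ht : 1 ≤ t) (c : ℝ) {q : (ZMod b)[X]} (hq : q.coeff 0 ≠ 0) :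
    qualityFactor b t c q = 1 + c * leadWeight b t q := by
  have hb : (1 : ℝ) < b := by exact_mod_cast (Fact.out : b.Prime).one_lt
  have hb0 : (0 : ℝ) < b := by linarith
  have key : (1 - (b : ℝ)) * ((⌊Real.logb b (radix b t q)⌋ : ℝ) + 1) = leadWeight b t q := by
    obtain ⟨t, rfl⟩ : ∃ s, t = s + 1 := ⟨t - 1, by omega⟩
    clear ht
    induction t with
    | zero => rw [floor_logb_radix_of_ne_zero hq, leadWeight_one hq]; simp
    | succ t ih =>
      rw [leadWeight]
      split_ifs with h
      · have hr : radix b (t + 1 + 1) q = radix b (t + 1) q / b := by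
          rw [radix, h]; simp
        rw [← ih, hr, Real.logb_div (radix_pos hq).ne' hb0.ne', Real.logb_self_eq_one hb,
          Int.floor_sub_one]
        push_cast; ring
      · rw [floor_logb_radix_of_ne_zero h]; simp
  rw [qualityFactor, vFrac_eq_radix, ← key, mul_assoc]

/-! ### Character sums over a polynomial lattice -/

/-- The additive character of the coefficient of `x^{-1}` of `K / x^t`. -/
def phase (b t : ℕ) [Fact b.Prime] (K : (ZMod b)[X]) : ℂ := ZMod.stdAddChar ((X * K).coeff t)

/-- The factor X in `phase` replaces index t - 1 by t, so level 0 carries the trivial character and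
can start the inductions. -/
lemma phase_zero_left (K : (ZMod b)[X]) : phase b 0 K = 1 := by simp [phase]

lemma phase_zero (t : ℕ) : phase b t 0 = 1 := by simp [phase]

lemma phase_sum {ι : Type*} (s : Finset ι) (t : ℕ) (K : ι → (ZMod b)[X]) :
    phase b t (∑ i ∈ s, K i) = ∏ i ∈ s, phase b t (K i) := by
  classical
  induction s using Finset.induction_on with
  | empty => simp [phase]
  | insert i s hi ih =>
    rw [Finset.sum_insert hi, Finset.prod_insert hi, ← ih]
    simp [phase, mul_add, AddChar.map_add_eq_mul]

lemma phase_succ {κ : ℕ} (hκ : κ < b) (t n : ℕ) (q : (ZMod b)[X]) :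
    phase b (t + 1) (natPoly b (κ + b * n) * q) =
      ZMod.stdAddChar ((κ : ZMod b) * q.coeff t) * phase b t (natPoly b n * q) := by
  rw [phase, phase, natPoly_add_mul (Fact.out : b.Prime).one_lt hκ, coeff_X_mul,
    ← AddChar.map_add_eq_mul]
  congr 1
  rw [add_mul, coeff_add, coeff_C_mul, mul_assoc]

lemma sum_stdAddChar_mul (a : ZMod b) :
    ∑ κ ∈ Finset.range b, (ZMod.stdAddChar ((κ : ZMod b) * a) : ℂ) = if a = 0 then (b : ℂ) else 0 := by
  rw [sum_range_natCast_zmod b fun c => (ZMod.stdAddChar (c * a) : ℂ),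
    AddChar.sum_mulShift a (ZMod.isPrimitive_stdAddChar b), ZMod.card]
  split_ifs <;> simp

open Classical in
-- Orthogonality of characters: summing over the lowest digit of n tests whether the coefficient of
-- x^(m-1) vanishes, and the other digits test the lower coefficients.
lemma sum_phase (m : ℕ) (K : (ZMod b)[X]) :
    ∑ n ∈ Finset.range (b ^ m), phase b m (natPoly b n * K) =
      if X ^ m ∣ K then (b : ℂ) ^ m else 0 := by
  induction m with
  | zero => simp [phase_zero_left]
  | succ m ih =>
    rw [pow_succ', sum_range_mul_eq]
    have h1 : ∀ n ∈ Finset.range (b ^ m), ∑ κ ∈ Finset.range b,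
        phase b (m + 1) (natPoly b (κ + b * n) * K) =
        (if K.coeff m = 0 then (b : ℂ) else 0) * phase b m (natPoly b n * K) := by
      intro n _
      rw [← sum_stdAddChar_mul, Finset.sum_mul]
      exact Finset.sum_congr rfl fun κ hκ => phase_succ (Finset.mem_range.mp hκ) _ _ _
    rw [Finset.sum_congr rfl h1, ← Finset.mul_sum, ih]
    have h2 : X ^ (m + 1) ∣ K ↔ K.coeff m = 0 ∧ X ^ m ∣ K := by
      simp only [X_pow_dvd_iff]
      refine ⟨fun h => ⟨h m (by omega), fun i hi => h i (by omega)⟩, fun h i hi => ?_⟩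
      rcases Nat.lt_succ_iff_lt_or_eq.mp hi with h' | rfl
      exacts [h.2 i h', h.1]
    rw [if_congr h2 rfl rfl, ite_and, pow_succ' (b : ℂ)]
    split_ifs <;> simp

/-- The weight `c b^{-⌊log_b k⌋}` of a nonzero frequency `k`; the frequency `0` has weight `a`. -/
def freqWeight (b : ℕ) (a c : ℝ) (k : ℕ) : ℝ := if k = 0 then a else c / (b : ℝ) ^ Nat.log b k

lemma freqWeight_nonneg {a c : ℝ} (ha : 0 ≤ a) (hc : 0 ≤ c) (k : ℕ) : 0 ≤ freqWeight b a c k := by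
  rw [freqWeight]; split_ifs <;> positivity

/-- Split off the lowest digit κ of h = κ + b n. The weight does not depend on κ, so the sum over κ
is b or 0 according to the top coefficient of q. The factor b lowers the logarithm by one when n ≠
0; for n = 0 it splits as (b - 1) + 1. -/
lemma sum_freqWeight_one_phase (t : ℕ) (q : (ZMod b)[X]) :
    ∑ h ∈ Finset.range (b ^ t), (freqWeight b 1 1 h : ℂ) * phase b t (natPoly b h * q) =
      leadWeight b t q := by
  have hb : 1 < b := (Fact.out : b.Prime).one_lt
  have hb0 : (b : ℂ) ≠ 0 := by exact_mod_cast (by omega : b ≠ 0)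
  induction t with
  | zero => simp [phase_zero_left, leadWeight, freqWeight]
  | succ t ih =>
    rw [pow_succ', sum_range_mul_eq]
    have h1 : ∀ n ∈ Finset.range (b ^ t), ∑ κ ∈ Finset.range b,
        (freqWeight b 1 1 (κ + b * n) : ℂ) * phase b (t + 1) (natPoly b (κ + b * n) * q) =
        if q.coeff t = 0 then (if n = 0 then (b : ℂ) - 1 else 0) +
          (freqWeight b 1 1 n : ℂ) * phase b t (natPoly b n * q) else 0 := by
      intro n _
      have h2 : ∀ κ ∈ Finset.range b, (freqWeight b 1 1 (κ + b * n) : ℂ) *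
          phase b (t + 1) (natPoly b (κ + b * n) * q) =
          ZMod.stdAddChar ((κ : ZMod b) * q.coeff t) *
            (freqWeight b 1 1 (b * n) * phase b t (natPoly b n * q)) := by
        intro κ hκ
        rw [Finset.mem_range] at hκ
        rw [phase_succ hκ]
        have : freqWeight b 1 1 (κ + b * n) = freqWeight b 1 1 (b * n) := by
          rcases eq_or_ne n 0 with rfl | hn
          · simp [freqWeight, Nat.log_of_lt hκ]
          · have := log_add_mul hb hκ hn
            have h0 := log_add_mul hb (show 0 < b by omega) hn
            rw [zero_add] at h0
            simp [freqWeight, this, h0, hn, show b ≠ 0 by omega]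
        rw [this]; ring
      rw [Finset.sum_congr rfl h2, ← Finset.sum_mul, sum_stdAddChar_mul]
      split_ifs with hq hn
      · subst hn
        simp [freqWeight, natPoly_zero hb, phase_zero]
      · have h0 := log_add_mul hb (show 0 < b by omega) hn
        rw [zero_add] at h0
        simp [freqWeight, h0, hn, show b ≠ 0 by omega, pow_succ]
        field_simp
      · simp
    rw [Finset.sum_congr rfl h1, leadWeight]
    split_ifs with hq
    · rw [Finset.sum_add_distrib, ih, Finset.sum_ite_eq', if_pos (Finset.mem_range.mpr (pow_pos (by omega) _))]
      push_cast; ring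
    · simp

lemma sum_freqWeight_phase (t : ℕ) (c : ℝ) (q : (ZMod b)[X]) :
    ∑ h ∈ Finset.range (b ^ t), (freqWeight b (1 + c) c h : ℂ) * phase b t (natPoly b h * q) =
      ((1 + c * leadWeight b t q : ℝ) : ℂ) := by
  have hb : 1 < b := (Fact.out : b.Prime).one_lt
  have h1 : ∀ h, (freqWeight b (1 + c) c h : ℂ) * phase b t (natPoly b h * q) =
      (if h = 0 then 1 else 0) + c * ((freqWeight b 1 1 h : ℂ) * phase b t (natPoly b h * q)) := by
    intro h
    rcases eq_or_ne h 0 with rfl | hh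
    · simp [freqWeight, natPoly_zero hb, phase_zero]
    · simp [freqWeight, hh]; ring
  rw [Finset.sum_congr rfl fun h _ => h1 h, Finset.sum_add_distrib, ← Finset.mul_sum,
    sum_freqWeight_one_phase, Finset.sum_ite_eq', if_pos (Finset.mem_range.mpr (pow_pos (by omega) _))]
  push_cast; ring

/-! ### The figure of merit -/

/-- The polynomial `k · g` whose divisibility by the modulus defines the dual lattice. -/
def dualPoly (b : ℕ) {d : ℕ} (g : Fin d → (ZMod b)[X]) (k : Fin d → ℕ) : (ZMod b)[X] :=
  ∑ j, natPoly b (k j) * g j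

lemma prod_phase {d : ℕ} (m : ℕ) (g : Fin d → (ZMod b)[X]) (k : Fin d → ℕ) (p : (ZMod b)[X]) :
    ∏ j, phase b m (natPoly b (k j) * (p * g j)) = phase b m (p * dualPoly b g k) := by
  rw [← phase_sum, dualPoly, Finset.mul_sum]
  exact congrArg _ (Finset.sum_congr rfl fun j _ => mul_left_comm _ _ _)

open Classical in
/-- The nonzero elements of the dual lattice whose components are less than `b ^ m`. -/
def dualBox (b m : ℕ) {d : ℕ} (g : Fin d → (ZMod b)[X]) : Finset (Fin d → ℕ) :=
  (Fintype.piFinset fun _ => Finset.range (b ^ m)).filter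
    fun k => k ≠ 0 ∧ X ^ m ∣ dualPoly b g k

/-- Expand every factor in characters and sum over n: only frequencies in the dual lattice survive,
and k = 0 yields ∏(1 + η_j). -/
lemma sum_prod_leadWeight {d : ℕ} (m : ℕ) (η : ℕ → ℝ) (g : Fin d → (ZMod b)[X]) :
    ∑ n ∈ Finset.range (b ^ m), ∏ j : Fin d, (1 + η j * leadWeight b m (natPoly b n * g j)) =
      (b : ℝ) ^ m * (∏ j : Fin d, (1 + η j) +
        ∑ k ∈ dualBox b m g, ∏ j : Fin d, freqWeight b (1 + η j) (η j) (k j)) := by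
  classical
  have hb : 1 < b := (Fact.out : b.Prime).one_lt
  have key : ∀ n ∈ Finset.range (b ^ m),
      ((∏ j : Fin d, (1 + η j * leadWeight b m (natPoly b n * g j)) : ℝ) : ℂ) =
      ∑ k ∈ Fintype.piFinset fun _ : Fin d => Finset.range (b ^ m),
        ((∏ j : Fin d, freqWeight b (1 + η j) (η j) (k j) : ℝ) : ℂ) *
          phase b m (natPoly b n * dualPoly b g k) := by
    intro n _
    rw [Complex.ofReal_prod, Finset.prod_congr rfl fun (j : Fin d) _ => (sum_freqWeight_phase m (η j)
      (natPoly b n * g j)).symm, Finset.prod_univ_sum]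
    refine Finset.sum_congr rfl fun k _ => ?_
    rw [Finset.prod_mul_distrib, prod_phase, Complex.ofReal_prod]
  apply Complex.ofReal_injective
  rw [Complex.ofReal_sum, Finset.sum_congr rfl key, Finset.sum_comm]
  simp_rw [← Finset.mul_sum, sum_phase, mul_ite, mul_zero]
  rw [← Finset.sum_filter]
  have hsplit : (Fintype.piFinset fun _ : Fin d => Finset.range (b ^ m)).filter
      (fun k => X ^ m ∣ dualPoly b g k) = insert 0 (dualBox b m g) := by
    ext k
    simp only [dualBox, Finset.mem_filter, Finset.mem_insert, Fintype.mem_piFinset,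
      Finset.mem_range]
    by_cases hk : k = 0
    · subst hk
      have : 0 < b ^ m := pow_pos (by omega) m
      simp [dualPoly, natPoly_zero hb, this]
    · simp [hk]
  rw [hsplit, Finset.sum_insert (by simp [dualBox]), ← Finset.sum_mul]
  push_cast
  simp [freqWeight]
  ring

lemma sum_dualBox_le {d : ℕ} (m : ℕ) {η : ℕ → ℝ} (hη : ∀ j, 0 ≤ η j) (g : Fin d → (ZMod b)[X]) :
    ∑ k ∈ dualBox b m g, ∏ j : Fin d, freqWeight b 1 (η j) (k j) ≤
      1 / (b : ℝ) ^ m * ∑ n ∈ Finset.range (b ^ m),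
        ∏ j : Fin d, (1 + η j * leadWeight b m (natPoly b n * g j)) - ∏ j : Fin d, (1 + η j) := by
  have hb0 : (0 : ℝ) < b := by exact_mod_cast (Fact.out : b.Prime).pos
  rw [sum_prod_leadWeight, ← mul_assoc, one_div, inv_mul_cancel₀ (pow_pos hb0 m).ne', one_mul,
    add_sub_cancel_left]
  -- The expansion gives a zero component the weight 1 + η_j; lowering it to 1 only decreases the
  -- sum.
  refine Finset.sum_le_sum fun k _ => Finset.prod_le_prod
    (fun j _ => freqWeight_nonneg zero_le_one (hη j) _) fun j _ => ?_
  rw [freqWeight, freqWeight]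
  split_ifs
  · linarith [hη j]
  · rfl

/-! ### Analysis of the digit-by-digit construction -/

/-- The positive integers below `b ^ t` that are not divisible by `b`. -/
def unitRange (b t : ℕ) : Finset ℕ := (Finset.Icc 1 (b ^ t - 1)).filter fun l => ¬ b ∣ l

/-- Every positive n below b^m is uniquely b^(m-t) l with b ∤ l; the induction separates the n
divisible by b. This is the grouping by t built into the quality function. -/
lemma sum_Ico_pow_eq {M : Type*} [AddCommMonoid M] (F : ℕ → M) (m : ℕ) :
    ∑ n ∈ Finset.Ico 1 (b ^ m), F n =
      ∑ t ∈ Finset.Icc 1 m, ∑ l ∈ unitRange b t, F (b ^ (m - t) * l) := by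
  have hb : 1 < b := (Fact.out : b.Prime).one_lt
  induction m generalizing F with
  | zero => simp
  | succ m ih =>
    have hI : Finset.Icc 1 (b ^ (m + 1) - 1) = Finset.Ico 1 (b ^ (m + 1)) := by
      have : 0 < b ^ (m + 1) := pow_pos (by omega) _
      ext n; simp only [Finset.mem_Icc, Finset.mem_Ico]; omega
    rw [Finset.sum_Icc_succ_top (by omega), ← Finset.sum_filter_add_sum_filter_not _ (fun n => b ∣ n)]
    congr 1
    · have h1 : ∑ t ∈ Finset.Icc 1 m, ∑ l ∈ unitRange b t, F (b ^ (m + 1 - t) * l) =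
          ∑ t ∈ Finset.Icc 1 m, ∑ l ∈ unitRange b t, F (b * (b ^ (m - t) * l)) := by
        refine Finset.sum_congr rfl fun t ht => Finset.sum_congr rfl fun l _ => ?_
        rw [show m + 1 - t = m - t + 1 by simp at ht; omega, pow_succ', mul_assoc]
      rw [h1, ← ih fun n => F (b * n)]
      symm
      refine Finset.sum_bij (fun n _ => b * n) ?_ ?_ ?_ ?_
      · intro n hn
        simp only [Finset.mem_filter, Finset.mem_Ico] at hn ⊢
        refine ⟨⟨Nat.mul_pos (by omega) hn.1, ?_⟩, dvd_mul_right b n⟩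
        rw [pow_succ']
        exact Nat.mul_lt_mul_of_pos_left hn.2 (by omega)
      · intro n _ n' _ h
        exact Nat.eq_of_mul_eq_mul_left (by omega) h
      · intro n hn
        simp only [Finset.mem_filter, Finset.mem_Ico] at hn
        obtain ⟨⟨h1, h2⟩, k, rfl⟩ := hn
        refine ⟨k, ?_, rfl⟩
        rw [pow_succ'] at h2
        rw [Finset.mem_Ico]
        exact ⟨Nat.pos_of_ne_zero (by rintro rfl; simp at h1), lt_of_mul_lt_mul_left h2 (by omega)⟩
      · intros; rfl
    · rw [unitRange, hI]
      simp

lemma leadWeight_congr_of_dvd {t : ℕ} {p q : (ZMod b)[X]} (h : X ^ t ∣ p - q) :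
    leadWeight b t p = leadWeight b t q :=
  leadWeight_congr fun i hi => sub_eq_zero.mp (by simpa using X_pow_dvd_iff.mp h i hi)

/-- As p is invertible modulo x, exactly one digit c annihilates the coefficient of x^w in p(q + c
x^w); all other digits give weight 0. -/
lemma sum_leadWeight_mul_add (w : ℕ) {p : (ZMod b)[X]} (hp : p.coeff 0 ≠ 0) (q : (ZMod b)[X]) :
    ∑ c : ZMod b, leadWeight b (w + 1) (p * (q + C c * X ^ w)) =
      (b - 1) + leadWeight b w (p * q) := by
  have h : ∀ c : ZMod b, leadWeight b (w + 1) (p * (q + C c * X ^ w)) =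
      if c = -(p * q).coeff w / p.coeff 0 then (b - 1) + leadWeight b w (p * q) else 0 := by
    intro c
    have h1 : leadWeight b w (p * (q + C c * X ^ w)) = leadWeight b w (p * q) :=
      leadWeight_congr_of_dvd ⟨p * C c, by ring⟩
    have h2 : (p * (q + C c * X ^ w)).coeff w = (p * q).coeff w + p.coeff 0 * c := by
      rw [mul_add, coeff_add, ← mul_assoc, coeff_mul_X_pow', if_pos le_rfl, Nat.sub_self,
        coeff_mul_C]
    rw [leadWeight, h1, h2]
    refine if_congr ?_ rfl rfl
    rw [eq_div_iff hp, add_comm, add_eq_zero_iff_eq_neg, mul_comm]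
  rw [Finset.sum_congr rfl fun c _ => h c, Finset.sum_ite_eq', if_pos (Finset.mem_univ _)]

lemma coeff_zero_natPoly_mul_ne_zero {t l : ℕ} (hl : l ∈ unitRange b t) {q : (ZMod b)[X]}
    (hq : q.coeff 0 ≠ 0) : (natPoly b l * q).coeff 0 ≠ 0 := by
  rw [mul_coeff_zero]
  exact mul_ne_zero (coeff_zero_natPoly_ne_zero (Fact.out : b.Prime).one_lt
    (Finset.mem_filter.mp hl).2) hq

/-- The nonconstant part of the digit-wise quality function. -/
def digitSum (b m : ℕ) (P : ℕ → ℕ → ℝ) (w : ℕ) (q : (ZMod b)[X]) : ℝ :=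
  ∑ t ∈ Finset.Icc w m, 1 / (b : ℝ) ^ (t - w) *
    ∑ l ∈ unitRange b t, P t l * leadWeight b w (natPoly b l * q)

/-- The constant part of the digit-wise quality function. -/
def digitBase (b m : ℕ) (P : ℕ → ℕ → ℝ) (w : ℕ) : ℝ :=
  ∑ t ∈ Finset.Icc w m, 1 / (b : ℝ) ^ (t - w) * ∑ l ∈ unitRange b t, P t l

lemma sum_Icc_geom_eq {m w : ℕ} (hw : w < m) (S : ℕ → ℝ) :
    ∑ t ∈ Finset.Icc w m, 1 / (b : ℝ) ^ (t - w) * S t =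
      S w + 1 / b * ∑ t ∈ Finset.Icc (w + 1) m, 1 / (b : ℝ) ^ (t - (w + 1)) * S t := by
  rw [← Finset.insert_Icc_add_one_left_eq_Icc hw.le, Finset.sum_insert (by simp), Finset.mul_sum]
  congr 1
  · simp
  · refine Finset.sum_congr rfl fun t ht => ?_
    rw [show t - w = t - (w + 1) + 1 by simp at ht; omega, pow_succ]
    field_simp

/-- The discount b^(w-t) is tuned to this: summing over the new digit returns b times the previous
digit sum without its t = w term, plus a constant. -/
lemma sum_digitSum_add {m w : ℕ} (hw : w < m) (P : ℕ → ℕ → ℝ) (q : (ZMod b)[X]) :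
    ∑ c : ZMod b, digitSum b m P (w + 1) (q + C c * X ^ w) =
      (b - 1) * digitBase b m P (w + 1) +
        b * (digitSum b m P w q - ∑ l ∈ unitRange b w, P w l * leadWeight b w (natPoly b l * q)) := by
  have hb0 : (b : ℝ) ≠ 0 := by exact_mod_cast (Fact.out : b.Prime).ne_zero
  rw [digitSum, sum_Icc_geom_eq hw, add_sub_cancel_left, ← mul_assoc, mul_one_div_cancel hb0,
    one_mul, digitBase, Finset.mul_sum, ← Finset.sum_add_distrib]
  simp only [digitSum]
  rw [Finset.sum_comm]
  refine Finset.sum_congr rfl fun t _ => ?_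
  rw [← Finset.mul_sum, Finset.sum_comm, mul_left_comm, ← mul_add]
  congr 1
  rw [Finset.mul_sum, ← Finset.sum_add_distrib]
  refine Finset.sum_congr rfl fun l hl => ?_
  rw [← Finset.mul_sum, sum_leadWeight_mul_add _ (coeff_zero_natPoly_ne_zero
    (Fact.out : b.Prime).one_lt (Finset.mem_filter.mp hl).2)]
  ring

/-- If each digit of `q m` minimizes the digit sum, then the mean of the leading zero weights
of `q m` is at most one. -/
lemma sum_leadWeight_le_of_minimizing {m : ℕ} (hm : 1 ≤ m) (P : ℕ → ℕ → ℝ)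
    (hP : ∀ t l, 0 ≤ P t l) (q : ℕ → (ZMod b)[X]) (hq1 : q 1 = 1)
    (hq : ∀ w, 1 ≤ w → w < m → (∃ c, q (w + 1) = q w + C c * X ^ w) ∧
      ∀ c', digitSum b m P (w + 1) (q (w + 1)) ≤ digitSum b m P (w + 1) (q w + C c' * X ^ w)) :
    ∑ t ∈ Finset.Icc 1 m, ∑ l ∈ unitRange b t, P t l * leadWeight b t (natPoly b l * q m) ≤
      ∑ t ∈ Finset.Icc 1 m, ∑ l ∈ unitRange b t, P t l := by
  have hb0 : (0 : ℝ) < b := by exact_mod_cast (Fact.out : b.Prime).pos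
  set U : ℕ → ℝ := fun w => ∑ l ∈ unitRange b w, P w l * leadWeight b w (natPoly b l * q w)
  set S : ℕ → ℝ := fun w => ∑ l ∈ unitRange b w, P w l
  -- Digits fixed later do not alter q modulo x^w, so level t of the sum is settled once t digits
  -- are known.
  have hdvd : ∀ w, 1 ≤ w → ∀ w', w ≤ w' → w' ≤ m → X ^ w ∣ q w' - q w := by
    intro w hw w' hww'
    induction w', hww' using Nat.le_induction with
    | base => intro _; simp
    | succ v hv ih =>
      intro hvm
      obtain ⟨⟨c, hc⟩, -⟩ := hq v (by omega) (by omega)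
      rw [hc, add_sub_right_comm]
      exact dvd_add (ih (by omega)) ((pow_dvd_pow X hv).mul_left _)
  have hU : ∀ t ∈ Finset.Icc 1 m,
      ∑ l ∈ unitRange b t, P t l * leadWeight b t (natPoly b l * q m) = U t := by
    intro t ht
    rw [Finset.mem_Icc] at ht
    refine Finset.sum_congr rfl fun l _ => ?_
    rw [leadWeight_congr_of_dvd (p := natPoly b l * q m) (q := natPoly b l * q t)]
    rw [← mul_sub]
    exact (hdvd t ht.1 m ht.2 le_rfl).mul_left _
  rw [Finset.sum_congr rfl hU]
  -- Invariant of the greedy choice: settled levels plus the current digit sum never exceed the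
  -- value obtained by replacing all leading zero weights by their mean 1.
  have key : ∀ w, 1 ≤ w → w ≤ m → digitSum b m P w (q w) + ∑ t ∈ Finset.Ico 1 w, U t ≤
      digitBase b m P w + ∑ t ∈ Finset.Ico 1 w, S t := by
    intro w hw
    induction w, hw using Nat.le_induction with
    | base =>
      intro _
      have h0 : digitSum b m P 1 (q 1) = 0 := by
        refine Finset.sum_eq_zero fun t _ => mul_eq_zero_of_right _ (Finset.sum_eq_zero fun l hl => ?_)
        rw [leadWeight_one (coeff_zero_natPoly_mul_ne_zero hl (by simp [hq1])), mul_zero]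
      simp only [h0, Finset.Ico_self, Finset.sum_empty, add_zero]
      exact Finset.sum_nonneg fun t _ => mul_nonneg (by positivity)
        (Finset.sum_nonneg fun l _ => hP t l)
    | succ w hw ih =>
      intro hwm
      -- A minimum over the b digits is at most their average.
      have h1 : b * digitSum b m P (w + 1) (q (w + 1)) ≤
          (b - 1) * digitBase b m P (w + 1) + b * (digitSum b m P w (q w) - U w) := by
        rw [← sum_digitSum_add (by omega) P (q w)]
        have := Finset.card_nsmul_le_sum Finset.univ
          (fun c => digitSum b m P (w + 1) (q w + C c * X ^ w)) _
          fun c _ => (hq w hw (by omega)).2 c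
        simpa [ZMod.card] using this
      have h2 : b * digitBase b m P w = b * S w + digitBase b m P (w + 1) := by
        rw [digitBase, sum_Icc_geom_eq (by omega), mul_add, ← mul_assoc,
          mul_one_div_cancel hb0.ne', one_mul, digitBase]
      have h3 := ih (by omega)
      rw [Finset.sum_Ico_succ_top hw, Finset.sum_Ico_succ_top hw]
      refine le_of_mul_le_mul_left ?_ hb0
      have h4 := mul_le_mul_of_nonneg_left h3 hb0.le
      nlinarith
  have hfin := key m hm le_rfl
  have e1 : digitSum b m P m (q m) = U m := by simp [digitSum, U]
  have e2 : digitBase b m P m = S m := by simp [digitBase, S]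
  rw [e1, e2, add_comm, add_comm (S m), ← Finset.sum_Ico_succ_top hm, ← Finset.sum_Ico_succ_top hm,
    Finset.Ico_add_one_right_eq_Icc] at hfin
  exact hfin

/-- The mean of `leadWeight` over all points is 1, since only the trivial character in its expansion
survives. -/
lemma sum_leadWeight_natPoly (m : ℕ) :
    ∑ n ∈ Finset.range (b ^ m), leadWeight b m (natPoly b n) = (b : ℝ) ^ m := by
  classical
  have hb : 1 < b := (Fact.out : b.Prime).one_lt
  apply Complex.ofReal_injective
  rw [Complex.ofReal_sum]
  simp_rw [← sum_freqWeight_one_phase]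
  rw [Finset.sum_comm, Finset.sum_eq_single 0]
  · simp [freqWeight, natPoly_zero hb, phase_zero]
  · intro h hh h0
    rw [← Finset.mul_sum, Finset.sum_congr rfl fun n _ => by rw [mul_comm (natPoly b h)],
      sum_phase, if_neg, mul_zero]
    intro hd
    exact h0 (eq_of_X_pow_dvd_natPoly_sub hb (Finset.mem_range.mp hh) (pow_pos (by omega) m)
      (by simpa [natPoly_zero hb] using hd))
  · intro h; exact absurd (Finset.mem_range.mpr (pow_pos (by omega) m)) h

/-! ### Analysis of the component-by-component construction -/

lemma coeff_zero_of_digit_steps {m : ℕ} {q : ℕ → (ZMod b)[X]} (h1 : q 1 = 1)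
    (hq : ∀ w ∈ Finset.Icc 2 m, ∃ c : ZMod b, q w = q (w - 1) + C c * X ^ (w - 1)) {w : ℕ}
    (hw1 : 1 ≤ w) (hwm : w ≤ m) : (q w).coeff 0 = 1 := by
  induction w, hw1 using Nat.le_induction with
  | base => simp [h1]
  | succ w hw1 ih =>
    obtain ⟨c, hc⟩ := hq (w + 1) (Finset.mem_Icc.mpr ⟨by omega, hwm⟩)
    rw [hc, Nat.add_sub_cancel, coeff_add, ih (by omega), coeff_C_mul, coeff_X_pow,
      if_neg (by omega)]
    simp

lemma coeff_zero_of_output {m d : ℕ} (hm : 1 ≤ m) {η : ℕ → ℝ} {g : Fin d → (ZMod b)[X]}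
    (hg : IsCBCDBDOutput b m d η g) (j : Fin d) : (g j).coeff 0 = 1 := by
  obtain ⟨G, h0, h1, hw, hgG⟩ := hg
  rw [hgG]
  rcases Nat.eq_zero_or_pos (j : ℕ) with hj | hj
  · simp [h0 j hj]
  · exact coeff_zero_of_digit_steps (h1 j hj)
      (fun w hwm => (hw j hj w hwm).imp fun c hc => hc.2) hm le_rfl

/-- The product of the quality factors of the first `r` components. -/
def partialQuality (b : ℕ) (η : ℕ → ℝ) {d : ℕ} (g : Fin d → (ZMod b)[X]) (r t l : ℕ) : ℝ :=
  ∏ j ∈ Finset.univ.filter (fun j : Fin d => (j : ℕ) < r),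
    (1 + η j * leadWeight b t (natPoly b l * g j))

lemma partialQuality_nonneg {η : ℕ → ℝ} (hη : ∀ j, 0 ≤ η j) {d : ℕ} (g : Fin d → (ZMod b)[X])
    (r t l : ℕ) : 0 ≤ partialQuality b η g r t l :=
  Finset.prod_nonneg fun j _ => add_nonneg zero_le_one (mul_nonneg (hη j) (leadWeight_nonneg _ _))

lemma filter_val_lt_succ {d : ℕ} (r : Fin d) :
    (Finset.univ.filter fun j : Fin d => (j : ℕ) < r + 1) =
      insert r (Finset.univ.filter fun j : Fin d => (j : ℕ) < r) := by
  ext j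
  simp only [Finset.mem_filter, Finset.mem_univ, true_and, Finset.mem_insert, Fin.ext_iff]
  omega

/-- With η_r > 0, minimizing the quality function is thus the same as minimizing `digitSum`. -/
lemma digitQuality_eq {m d : ℕ} (hm : 1 ≤ m) {η : ℕ → ℝ} {g : Fin d → (ZMod b)[X]}
    (hg : IsCBCDBDOutput b m d η g) (r : Fin d) {w : ℕ} (hw : 1 ≤ w) {q : (ZMod b)[X]}
    (hq : q.coeff 0 ≠ 0) :
    digitQuality b m η g r w q = digitBase b m (partialQuality b η g r) w +
      η r * digitSum b m (partialQuality b η g r) w q := by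
  rw [digitQuality, digitBase, digitSum, Finset.mul_sum, ← Finset.sum_add_distrib]
  refine Finset.sum_congr rfl fun t ht => ?_
  rw [mul_left_comm, ← mul_add]
  congr 1
  rw [Finset.mul_sum, ← Finset.sum_add_distrib]
  refine Finset.sum_congr rfl fun l hl => ?_
  have hI : Finset.Iio r = Finset.univ.filter fun j : Fin d => (j : ℕ) < r := by
    ext j; simp only [Finset.mem_Iio, Finset.mem_filter, Finset.mem_univ, true_and]; rfl
  have hprod : ∏ j ∈ Finset.Iio r, qualityFactor b t (η j) (natPoly b l * g j) =
      partialQuality b η g r t l := by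
    rw [partialQuality, hI]
    refine Finset.prod_congr rfl fun j _ => ?_
    rw [qualityFactor_eq (hw.trans (Finset.mem_Icc.mp ht).1) _
      (coeff_zero_natPoly_mul_ne_zero hl (by simp [coeff_zero_of_output hm hg j]))]
  rw [hprod, qualityFactor_eq hw _ (coeff_zero_natPoly_mul_ne_zero hl hq)]
  ring

/-- The sum of the quality products of the first `r` components over the nonzero points. -/
def meritSum (b m : ℕ) (η : ℕ → ℝ) {d : ℕ} (g : Fin d → (ZMod b)[X]) (r : ℕ) : ℝ :=
  ∑ t ∈ Finset.Icc 1 m, ∑ l ∈ unitRange b t, partialQuality b η g r t l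

/-- Multiplying by x^(m-t) while raising the level from t to m leaves the leading zeros unchanged.
-/
lemma meritSum_eq {m d : ℕ} (hm : 1 ≤ m) {η : ℕ → ℝ} {g : Fin d → (ZMod b)[X]}
    (hg : IsCBCDBDOutput b m d η g) :
    meritSum b m η g d = ∑ n ∈ Finset.Ico 1 (b ^ m),
      ∏ j : Fin d, (1 + η j * leadWeight b m (natPoly b n * g j)) := by
  rw [sum_Ico_pow_eq, meritSum]
  refine Finset.sum_congr rfl fun t ht => Finset.sum_congr rfl fun l hl => ?_
  rw [partialQuality, Finset.filter_true_of_mem fun j _ => j.2]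
  refine Finset.prod_congr rfl fun j _ => ?_
  obtain ⟨s, rfl⟩ := Nat.exists_eq_add_of_le (Finset.mem_Icc.mp ht).2
  rw [Nat.add_sub_cancel_left, natPoly_pow_mul (Fact.out : b.Prime).one_lt, mul_assoc,
    leadWeight_X_pow_mul (Finset.mem_Icc.mp ht).1 _
      (coeff_zero_natPoly_mul_ne_zero hl (by simp [coeff_zero_of_output hm hg j]))]

lemma sum_unitRange_leadWeight_le (m : ℕ) :
    ∑ t ∈ Finset.Icc 1 m, ∑ l ∈ unitRange b t, leadWeight b t (natPoly b l) ≤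
      (b : ℝ) ^ m - 1 := by
  have hb : 1 < b := (Fact.out : b.Prime).one_lt
  have hb' : (1 : ℝ) ≤ b := by exact_mod_cast hb.le
  have h1 : ∑ t ∈ Finset.Icc 1 m, ∑ l ∈ unitRange b t, leadWeight b t (natPoly b l) =
      ∑ n ∈ Finset.Ico 1 (b ^ m), leadWeight b m (natPoly b n) := by
    rw [sum_Ico_pow_eq]
    refine Finset.sum_congr rfl fun t ht => Finset.sum_congr rfl fun l hl => ?_
    obtain ⟨s, rfl⟩ := Nat.exists_eq_add_of_le (Finset.mem_Icc.mp ht).2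
    rw [Nat.add_sub_cancel_left, natPoly_pow_mul hb, leadWeight_X_pow_mul (Finset.mem_Icc.mp ht).1
      _ (coeff_zero_natPoly_ne_zero hb (Finset.mem_filter.mp hl).2)]
  have h2 := sum_leadWeight_natPoly (b := b) m
  rw [Finset.range_eq_Ico, Finset.sum_eq_sum_Ico_succ_bot (pow_pos (by omega) m), natPoly_zero hb,
    leadWeight_zero, zero_add] at h2
  have h3 : 0 ≤ (m : ℝ) * ((b : ℝ) - 1) := mul_nonneg (Nat.cast_nonneg m) (by linarith)
  rw [h1]; linarith

lemma meritSum_succ_le {m d : ℕ} (hm : 1 ≤ m) {η : ℕ → ℝ} (hη : ∀ j, 0 < η j)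
    {g : Fin d → (ZMod b)[X]} (hg : IsCBCDBDOutput b m d η g) (r : Fin d) :
    meritSum b m η g (r + 1) ≤ (1 + η r) * meritSum b m η g r := by
  have hη' : ∀ j, 0 ≤ η j := fun j => (hη j).le
  have h1 : meritSum b m η g (r + 1) = meritSum b m η g r + η r * ∑ t ∈ Finset.Icc 1 m,
      ∑ l ∈ unitRange b t, partialQuality b η g r t l * leadWeight b t (natPoly b l * g r) := by
    simp only [meritSum, Finset.mul_sum, ← Finset.sum_add_distrib]
    refine Finset.sum_congr rfl fun t _ => Finset.sum_congr rfl fun l _ => ?_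
    rw [partialQuality, filter_val_lt_succ, Finset.prod_insert (by simp), ← partialQuality]
    ring
  have h2 : ∑ t ∈ Finset.Icc 1 m, ∑ l ∈ unitRange b t,
      partialQuality b η g r t l * leadWeight b t (natPoly b l * g r) ≤ meritSum b m η g r := by
    have hg' := hg
    obtain ⟨G, h0, hG1, hw, hgG⟩ := hg'
    rcases Nat.eq_zero_or_pos (r : ℕ) with hr | hr
    -- The first component is prescribed rather than minimized; for g = 1 the mean of `leadWeight`
    -- is computed directly.
    · have hP : ∀ t l, partialQuality b η g r t l = 1 := by simp [partialQuality, hr]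
      have hcard := sum_Ico_pow_eq (b := b) (fun _ => (1 : ℝ)) m
      simp only [meritSum, hP, one_mul, ← hcard, hgG, h0 r hr, mul_one]
      refine (sum_unitRange_leadWeight_le m).trans (le_of_eq ?_)
      have : 1 ≤ b ^ m := Nat.one_le_pow _ _ (Fact.out : b.Prime).pos
      simp [this]
    · rw [hgG]
      have hcoeff : ∀ w, 1 ≤ w → w ≤ m → (G r w).coeff 0 = 1 := fun w hw1 hwm =>
        coeff_zero_of_digit_steps (hG1 r hr)
          (fun v hv => (hw r hr v hv).imp fun c hc => hc.2) hw1 hwm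
      refine sum_leadWeight_le_of_minimizing hm _ (partialQuality_nonneg hη' g r) (G r)
        (hG1 r hr) fun w hw1 hwm => ?_
      obtain ⟨c, hmin, hc⟩ := hw r hr (w + 1) (Finset.mem_Icc.mpr ⟨by omega, hwm⟩)
      rw [Nat.add_sub_cancel] at hmin hc
      refine ⟨⟨c, hc⟩, fun c' => ?_⟩
      have hne : ∀ a : ZMod b, (G r w + C a * X ^ w).coeff 0 ≠ 0 := by
        intro a
        rw [coeff_add, hcoeff w hw1 hwm.le, coeff_C_mul, coeff_X_pow, if_neg (by omega)]
        simp
      have := hmin c'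
      rw [digitQuality_eq hm hg r (by omega) (hne c), digitQuality_eq hm hg r (by omega) (hne c'),
        add_le_add_iff_left] at this
      rw [hc]
      exact le_of_mul_le_mul_left this (hη r)
  rw [h1, add_mul, one_mul]
  exact add_le_add_right (mul_le_mul_of_nonneg_left h2 (hη' r)) _

lemma meritSum_le {m d : ℕ} (hm : 1 ≤ m) {η : ℕ → ℝ} (hη : ∀ j, 0 < η j)
    {g : Fin d → (ZMod b)[X]} (hg : IsCBCDBDOutput b m d η g) (r : ℕ) (hr : r ≤ d) :
    meritSum b m η g r ≤ (∏ j ∈ Finset.range r, (1 + η j)) * (b : ℝ) ^ m := by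
  induction r with
  | zero =>
    have hcard := sum_Ico_pow_eq (b := b) (fun _ => (1 : ℝ)) m
    have : 1 ≤ b ^ m := Nat.one_le_pow _ _ (Fact.out : b.Prime).pos
    simp only [meritSum, partialQuality, not_lt_zero, Finset.filter_false, Finset.prod_empty,
      ← hcard]
    simp [this]
  | succ r ih =>
    refine (meritSum_succ_le hm hη hg ⟨r, hr⟩).trans ?_
    rw [Finset.prod_range_succ, mul_right_comm, mul_comm]
    exact mul_le_mul_of_nonneg_right (ih (by omega)) (by linarith [hη r])

lemma sum_dualBox_le_of_output {m d : ℕ} (hm : 1 ≤ m) {η : ℕ → ℝ} (hη : ∀ j, 0 < η j)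
    {g : Fin d → (ZMod b)[X]} (hg : IsCBCDBDOutput b m d η g) :
    ∑ k ∈ dualBox b m g, ∏ j : Fin d, freqWeight b 1 (η j) (k j) ≤
      1 / (b : ℝ) ^ m * ∏ j ∈ Finset.range d, (1 + b * η j * m) := by
  have hb : 1 < b := (Fact.out : b.Prime).one_lt
  have hb0 : (0 : ℝ) < b := by exact_mod_cast (Fact.out : b.Prime).pos
  refine (sum_dualBox_le m (fun j => (hη j).le) g).trans ?_
  rw [Finset.range_eq_Ico, Finset.sum_eq_sum_Ico_succ_bot (pow_pos (by omega) m), zero_add,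
    ← meritSum_eq hm hg, mul_add, add_sub_assoc]
  have h1 := meritSum_le hm hη hg d le_rfl
  rw [← Fin.prod_univ_eq_prod_range (fun j => 1 + η j)] at h1
  have h2 : 1 / (b : ℝ) ^ m * meritSum b m η g d ≤ ∏ j : Fin d, (1 + η j) := by
    rw [one_div, inv_mul_le_iff₀ (pow_pos hb0 m), mul_comm]; exact h1
  have h3 : ∏ j : Fin d, (1 + η j * leadWeight b m (natPoly b 0 * g j)) ≤
      ∏ j ∈ Finset.range d, (1 + b * η j * m) := by
    rw [← Fin.prod_univ_eq_prod_range (fun j => 1 + b * η j * m)]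
    refine Finset.prod_le_prod
      (fun j _ => add_nonneg zero_le_one (mul_nonneg (hη j).le (leadWeight_nonneg _ _)))
      fun j _ => ?_
    rw [natPoly_zero hb, zero_mul, leadWeight_zero]
    -- The n = 0 weight 1 + m(b - 1) is at most b m because m ≥ 1; this is the source of the
    -- constant b.
    have hm' : (1 : ℝ) ≤ m := by exact_mod_cast hm
    nlinarith [mul_nonneg (hη j).le (sub_nonneg.mpr hm')]
  have h4 := mul_le_mul_of_nonneg_left h3 (show 0 ≤ 1 / (b : ℝ) ^ m by positivity)
  linarith

/-! ### Subexponential growth of products with summable weights -/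

/-- The tail beyond J has sum below ε/2 and costs exp(εm/2). Each of the first J factors satisfies 1
+ y m ≤ (1 + y/e)(1 + e m) ≤ (1 + y/e) exp(e m), with e so small that J e ≤ ε/2. -/
lemma exists_prod_one_add_mul_le {y : ℕ → ℝ} (hy : ∀ j, 0 ≤ y j) (hs : Summable y) {ε : ℝ}
    (hε : 0 < ε) : ∃ c : ℝ, 0 < c ∧ ∀ d m : ℕ,
      ∏ j ∈ Finset.range d, (1 + y j * m) ≤ c * Real.exp (ε * m) := by
  obtain ⟨J, hJ⟩ := ((tendsto_sum_nat_add y).eventually (gt_mem_nhds (half_pos hε))).exists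
  set e := ε / 2 / (J + 1)
  have he : 0 < e := by positivity
  refine ⟨∏ j ∈ Finset.range J, (1 + y j / e),
    Finset.prod_pos fun j _ => by have := hy j; positivity, fun d m => ?_⟩
  have hone : ∀ j, 1 ≤ 1 + y j * m := fun j => by
    have := mul_nonneg (hy j) (Nat.cast_nonneg (α := ℝ) m); linarith
  have h1 : ∏ j ∈ Finset.range d, (1 + y j * m) ≤ ∏ j ∈ Finset.range (J + d), (1 + y j * m) :=
    Finset.prod_le_prod_of_subset_of_one_le (Finset.range_mono (by omega))
      (fun j _ => zero_le_one.trans (hone j)) fun j _ _ => hone j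
  have h2 : ∏ j ∈ Finset.range J, (1 + y j * m) ≤
      (∏ j ∈ Finset.range J, (1 + y j / e)) * Real.exp (ε / 2 * m) := by
    have h3 : ∏ j ∈ Finset.range J, (1 + y j * m) ≤
        ∏ j ∈ Finset.range J, ((1 + y j / e) * Real.exp (e * m)) := by
      refine Finset.prod_le_prod (fun j _ => zero_le_one.trans (hone j)) fun j _ => ?_
      have hyj : 0 ≤ y j / e := div_nonneg (hy j) he.le
      have h4 : 1 + y j * m ≤ (1 + y j / e) * (1 + e * m) := by
        have h5 : y j / e * (e * m) = y j * m := by field_simp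
        have h6 : 0 ≤ e * m := by positivity
        nlinarith
      refine h4.trans (mul_le_mul_of_nonneg_left ?_ (by linarith))
      rw [add_comm]; exact Real.add_one_le_exp _
    refine h3.trans ?_
    rw [Finset.prod_mul_distrib, Finset.prod_const, Finset.card_range, ← Real.exp_nat_mul]
    refine mul_le_mul_of_nonneg_left (Real.exp_le_exp.mpr ?_)
      (Finset.prod_nonneg fun j _ => by have := hy j; positivity)
    have h7 : (J : ℝ) * e ≤ ε / 2 := by
      have : (J + 1) * e = ε / 2 := by simp only [e]; field_simp
      linarith
    nlinarith [mul_le_mul_of_nonneg_right h7 (Nat.cast_nonneg (α := ℝ) m)]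
  have h3 : ∏ i ∈ Finset.range d, (1 + y (J + i) * m) ≤ Real.exp (ε / 2 * m) := by
    refine (Real.prod_one_add_le_exp_sum _
      fun i => mul_nonneg (hy _) (Nat.cast_nonneg m)).trans (Real.exp_le_exp.mpr ?_)
    rw [← Finset.sum_mul]
    refine mul_le_mul_of_nonneg_right (le_trans ?_ hJ.le) (Nat.cast_nonneg m)
    simp_rw [add_comm J]
    exact ((summable_nat_add_iff J).mpr hs).sum_le_tsum _ fun i _ => hy _
  refine h1.trans ?_
  rw [Finset.prod_range_add]
  have h4 := mul_le_mul h2 h3 (Finset.prod_nonneg fun i _ => zero_le_one.trans (hone _))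
    (mul_nonneg (Finset.prod_nonneg fun j _ => by have := hy j; positivity) (Real.exp_nonneg _))
  refine h4.trans (le_of_eq ?_)
  rw [mul_assoc, ← Real.exp_add]
  congr 2; ring

/-- The figure of merit of the generating vectors returned by the algorithm. -/
theorem exists_sum_dualBox_le (b : ℕ) [Fact b.Prime] {η : ℕ → ℝ} (hη : ∀ j, 0 < η j)
    (hs : Summable η) {δ : ℝ} (hδ : 0 < δ) :
    ∃ c : ℝ, 0 < c ∧ ∀ m d : ℕ, 1 ≤ m → ∀ g : Fin d → (ZMod b)[X], IsCBCDBDOutput b m d η g →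
      ∑ k ∈ dualBox b m g, ∏ j : Fin d, freqWeight b 1 (η j) (k j) ≤
        1 / (b : ℝ) ^ m * (c * ((b : ℝ) ^ m) ^ δ) := by
  have hb : (1 : ℝ) < b := by exact_mod_cast (Fact.out : b.Prime).one_lt
  have hb0 : (0 : ℝ) < b := by linarith
  -- The choice ε = δ log b turns exp(εm) into N^δ.
  obtain ⟨c, hc, hcb⟩ := exists_prod_one_add_mul_le (y := fun j => b * η j)
    (fun j => mul_nonneg hb0.le (hη j).le) (hs.mul_left _) (mul_pos hδ (Real.log_pos hb))
  refine ⟨c, hc, fun m d hm g hg => (sum_dualBox_le_of_output hm hη hg).trans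
    (mul_le_mul_of_nonneg_left ((hcb d m).trans (le_of_eq ?_)) (by positivity))⟩
  rw [Real.rpow_def_of_pos (pow_pos hb0 m), Real.log_pow]
  congr 2; ring

/-! ### The worst-case error as a sum over the dual lattice -/

/-- The reciprocal `c b^{-α ⌊log_b k⌋}` of the one-dimensional decay function, `1` for `k = 0`. -/
def coordWeight (b : ℕ) (α c : ℝ) (k : ℕ) : ℝ :=
  if k = 0 then 1 else c * (b : ℝ) ^ (-(α * (Nat.log b k : ℝ)))

lemma coordWeight_nonneg {α c : ℝ} (hc : 0 ≤ c) (k : ℕ) : 0 ≤ coordWeight b α c k := by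
  rw [coordWeight]; split_ifs <;> positivity

lemma weightedDecay_pos {α : ℝ} {γ : ℕ → ℝ} (hγ : ∀ j, 0 < γ j) {d : ℕ} (k : Fin d → ℕ) :
    0 < weightedDecay b α γ k := by
  have hb0 : (0 : ℝ) < b := by exact_mod_cast (Fact.out : b.Prime).pos
  refine mul_pos (inv_pos.mpr (Finset.prod_pos fun j _ => hγ j)) (Finset.prod_pos fun j _ => ?_)
  rw [decay]; split_ifs <;> positivity

lemma inv_weightedDecay (α : ℝ) (γ : ℕ → ℝ) {d : ℕ} (k : Fin d → ℕ) :
    (weightedDecay b α γ k)⁻¹ = ∏ j : Fin d, coordWeight b α (γ j) (k j) := by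
  have hb0 : (0 : ℝ) < b := by exact_mod_cast (Fact.out : b.Prime).pos
  rw [weightedDecay, mul_inv, inv_inv, Finset.prod_filter, ← Finset.prod_inv_distrib,
    ← Finset.prod_mul_distrib]
  refine Finset.prod_congr rfl fun j _ => ?_
  rw [decay, coordWeight]
  by_cases h : k j = 0
  · simp [h]
  · simp [h, Real.rpow_neg hb0.le]

lemma enorm_walshCoeff_le {α : ℝ} {γ : ℕ → ℝ} (hγ : ∀ j, 0 < γ j) {d : ℕ}
    {f : (Fin d → ℝ) → ℂ} (hf : walshNorm b α γ f ≤ 1) (k : Fin d → ℕ) :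
    ‖walshCoeff b f k‖ₑ ≤ ENNReal.ofReal (∏ j : Fin d, coordWeight b α (γ j) (k j)) := by
  have h := (le_iSup (fun k : Fin d → ℕ =>
    ‖walshCoeff b f k‖ₑ * ENNReal.ofReal (weightedDecay b α γ k)) k).trans hf
  rw [← inv_weightedDecay, ENNReal.ofReal_inv_of_pos (weightedDecay_pos hγ k)]
  exact ENNReal.le_inv_iff_mul_le.mpr h

lemma walVec_latticePoint (m n : ℕ) {d : ℕ} (g : Fin d → (ZMod b)[X]) (k : Fin d → ℕ) :
    walVec b k (latticePoint b m g (X ^ m) n) = phase b m (natPoly b n * dualPoly b g k) := by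
  rw [walVec, ← prod_phase]
  refine Finset.prod_congr rfl fun j _ => ?_
  rw [latticePoint, vFrac_eq_radix, wal_radix, phase]

open Classical in
lemma hasSum_qmcRule {m d : ℕ} {α : ℝ} {γ : ℕ → ℝ} (g : Fin d → (ZMod b)[X])
    {f : (Fin d → ℝ) → ℂ} (hf : f ∈ walshSpace b d α γ) :
    HasSum (fun k : Fin d → ℕ => if X ^ m ∣ dualPoly b g k then walshCoeff b f k else 0)
      (qmcRule (b ^ m) (latticePoint b m g (X ^ m)) f) := by
  have hb0 : (b : ℂ) ≠ 0 := by exact_mod_cast (Fact.out : b.Prime).ne_zero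
  have h1 : ∀ n ∈ Finset.range (b ^ m), HasSum (fun k : Fin d → ℕ =>
      walshCoeff b f k * walVec b k (latticePoint b m g (X ^ m) n))
      (f (latticePoint b m g (X ^ m) n)) := by
    intro n _
    refine hf.2.1 _ fun j => ?_
    rw [latticePoint, vFrac_eq_radix]
    exact ⟨radix_nonneg _ _, radix_lt_one _ _⟩
  have h2 := (hasSum_sum h1).mul_left (1 / ((b ^ m : ℕ) : ℂ))
  rw [qmcRule]
  refine (congrArg (HasSum · _) (funext fun k => ?_)).mp h2
  rw [← Finset.mul_sum, Finset.sum_congr rfl fun n _ => walVec_latticePoint m n g k, sum_phase]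
  split_ifs
  · push_cast; field_simp
  · simp

lemma walshCoeff_zero {d : ℕ} (f : (Fin d → ℝ) → ℂ) : walshCoeff b f 0 = cubeIntegral f := by
  simp [walshCoeff, walVec, wal]

open Classical in
-- The zero frequency integrates exactly and cancels; the unit ball bounds each other coefficient by
-- the reciprocal of the decay function.
lemma latticeError_le_tsum {m d : ℕ} {α : ℝ} {γ : ℕ → ℝ} (hγ : ∀ j, 0 < γ j)
    (g : Fin d → (ZMod b)[X]) :
    latticeError b m d α γ g ≤ ∑' k : Fin d → ℕ, if k ≠ 0 ∧ X ^ m ∣ dualPoly b g k then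
      ENNReal.ofReal (∏ j : Fin d, coordWeight b α (γ j) (k j)) else 0 := by
  have hb : 1 < b := (Fact.out : b.Prime).one_lt
  refine iSup₂_le fun f hf => ?_
  have h0 : HasSum (fun k : Fin d → ℕ => if k = 0 then walshCoeff b f 0 else 0)
      (cubeIntegral f) := by
    rw [← walshCoeff_zero (b := b)]
    exact hasSum_ite_eq 0 _
  rw [← (h0.sub (hasSum_qmcRule g hf.1)).tsum_eq]
  refine enorm_tsum_le_tsum_enorm.trans (ENNReal.tsum_le_tsum fun k => ?_)
  by_cases hk : k = 0
  · subst hk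
    simp [dualPoly, natPoly_zero hb]
  · by_cases hd : X ^ m ∣ dualPoly b g k
    · simpa [hk, hd] using enorm_walshCoeff_le hγ hf.2 k
    · simp [hk, hd]

/-! ### Frequencies outside the box -/

lemma tsum_prod_fin {n : ℕ} (f : Fin n → ℕ → ℝ≥0∞) :
    ∑' k : Fin n → ℕ, ∏ i, f i (k i) = ∏ i, ∑' a, f i a := by
  induction n with
  | zero => simp
  | succ n ih =>
    rw [← (Fin.insertNthEquiv (fun _ => ℕ) 0).tsum_eq, ENNReal.tsum_prod', Fin.prod_univ_succ,
      ← ih, ← ENNReal.tsum_mul_right]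
    refine tsum_congr fun a => ?_
    rw [← ENNReal.tsum_mul_left]
    refine tsum_congr fun k => ?_
    rw [Fin.prod_univ_succ]
    simp [Fin.insertNthEquiv]

/-- The sum of `b^{-α ⌊log_b k⌋}` over the positive integers `k`. -/
def decaySum (b : ℕ) (α : ℝ) : ℝ≥0∞ :=
  ∑' k : ℕ, if k = 0 then 0 else ENNReal.ofReal ((b : ℝ) ^ (-(α * (Nat.log b k : ℝ))))

/-- Since k ≤ b · b^⌊log_b k⌋, the terms are at most b^α k^(-α). -/
lemma decaySum_lt_top {α : ℝ} (hα : 1 < α) : decaySum b α < ∞ := by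
  have hb : 1 < b := (Fact.out : b.Prime).one_lt
  have hb0 : (0 : ℝ) < b := by exact_mod_cast (Fact.out : b.Prime).pos
  have hs : Summable fun k : ℕ => (b : ℝ) ^ α * (k : ℝ) ^ (-α) :=
    (Real.summable_nat_rpow.mpr (by linarith)).mul_left _
  refine lt_of_le_of_lt (ENNReal.tsum_le_tsum fun k => ?_) hs.tsum_ofReal_lt_top
  split_ifs with hk
  · exact zero_le
  · refine ENNReal.ofReal_le_ofReal ?_
    have hk0 : (0 : ℝ) < k := by exact_mod_cast Nat.pos_of_ne_zero hk
    have h1 : (k : ℝ) ≤ b * (b : ℝ) ^ Nat.log b k := by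
      rw [← pow_succ']
      exact_mod_cast (Nat.lt_pow_succ_log_self hb k).le
    have h2 := Real.rpow_le_rpow hk0.le h1 (by linarith : 0 ≤ α)
    rw [Real.mul_rpow hb0.le (by positivity), ← Real.rpow_natCast, ← Real.rpow_mul hb0.le] at h2
    rw [Real.rpow_neg hb0.le, Real.rpow_neg hk0.le, mul_comm α, ← div_eq_mul_inv, inv_eq_one_div,
      div_le_div_iff₀ (by positivity) (by positivity), one_mul]
    exact h2

lemma tsum_coordWeight {α c : ℝ} (hc : 0 ≤ c) :
    ∑' k, ENNReal.ofReal (coordWeight b α c k) = 1 + ENNReal.ofReal c * decaySum b α := by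
  have h : ∀ k, ENNReal.ofReal (coordWeight b α c k) = (if k = 0 then 1 else 0) +
      ENNReal.ofReal c *
        (if k = 0 then 0 else ENNReal.ofReal ((b : ℝ) ^ (-(α * (Nat.log b k : ℝ))))) := by
    intro k
    rw [coordWeight]
    split_ifs
    · simp
    · rw [ENNReal.ofReal_mul hc, zero_add]
  simp_rw [h]
  rw [ENNReal.tsum_add, ENNReal.tsum_mul_left, tsum_ite_eq, decaySum]

open Classical in
-- Write a = h + N k with k ≥ 1. The weight is N^(-α) times that of k, independently of h, and the
-- congruence admits at most one h since g is invertible modulo x^m.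
lemma tsum_coordWeight_large_le {m : ℕ} {α c : ℝ} (hc : 0 ≤ c) {g : (ZMod b)[X]}
    (hg : g.coeff 0 ≠ 0) (R : (ZMod b)[X]) :
    (∑' a : ℕ, if b ^ m ≤ a ∧ X ^ m ∣ natPoly b a * g + R then
      ENNReal.ofReal (coordWeight b α c a) else 0) ≤
      ENNReal.ofReal (c * ((b : ℝ) ^ m) ^ (-α)) * decaySum b α := by
  have hb : 1 < b := (Fact.out : b.Prime).one_lt
  have hb0 : (0 : ℝ) < b := by exact_mod_cast (Fact.out : b.Prime).pos
  have : NeZero (b ^ m) := ⟨pow_ne_zero _ (by omega)⟩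
  rw [← (Nat.divModEquiv (b ^ m)).symm.tsum_eq, ENNReal.tsum_prod', decaySum,
    ← ENNReal.tsum_mul_left]
  refine ENNReal.tsum_le_tsum fun k => ?_
  rw [tsum_fintype]
  have hsymm : ∀ h, (Nat.divModEquiv (b ^ m)).symm (k, h) = k * b ^ m + h := fun _ => rfl
  split_ifs with hk
  · subst hk
    refine (Finset.sum_eq_zero fun h _ => if_neg fun hh => ?_).trans_le zero_le
    rw [hsymm] at hh
    have := h.2
    omega
  · have hterm : ∀ (h : Fin (b ^ m)) (a : ℕ), a = k * b ^ m + h → (if b ^ m ≤ a ∧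
        X ^ m ∣ natPoly b a * g + R then ENNReal.ofReal (coordWeight b α c a) else 0) =
        if X ^ m ∣ natPoly b h * g + R then ENNReal.ofReal (c * ((b : ℝ) ^ m) ^ (-α)) *
          ENNReal.ofReal ((b : ℝ) ^ (-(α * (Nat.log b k : ℝ)))) else 0 := by
      intro h a ha
      have e : a = h + b ^ m * k := by rw [ha]; ring
      have h1 : b ^ m ≤ h + b ^ m * k := by
        have := Nat.mul_le_mul_left (b ^ m) (Nat.one_le_iff_ne_zero.mpr hk)
        omega
      have h2 : (h : ℕ) + b ^ m * k ≠ 0 := by have := NeZero.pos (b ^ m); omega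
      rw [e, natPoly_add_pow_mul hb h.2]
      refine if_congr ?_ ?_ rfl
      · rw [and_iff_right h1, add_mul, mul_assoc, add_right_comm,
          dvd_add_left (dvd_mul_right _ _)]
      · rw [coordWeight, if_neg h2, log_add_pow_mul hb h.2 hk, ← ENNReal.ofReal_mul (by positivity),
          mul_assoc, ← Real.rpow_natCast, ← Real.rpow_mul hb0.le, ← Real.rpow_add hb0]
        congr 3
        push_cast; ring
    refine (Finset.sum_congr rfl fun h _ => hterm h _ (hsymm h)).trans_le ?_
    rw [← Finset.sum_filter, Finset.sum_const]
    refine (nsmul_le_nsmul_left zero_le (Finset.card_le_one.mpr ?_)).trans (one_nsmul _).le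
    intro h hh h' hh'
    simp only [Finset.mem_filter, Finset.mem_univ, true_and] at hh hh'
    refine Fin.ext (eq_of_X_pow_dvd_natPoly_sub hb h.2 h'.2 ?_)
    refine prime_X.pow_dvd_of_dvd_mul_right m (fun hX => hg (X_dvd_iff.mp hX)) ?_
    have := dvd_sub hh hh'
    rwa [add_sub_add_right_eq_sub, ← sub_mul] at this

open Classical in
lemma tsum_large_coord_le {m n : ℕ} {α : ℝ} {γ : ℕ → ℝ} (hγ : ∀ j, 0 ≤ γ j)
    {g : Fin (n + 1) → (ZMod b)[X]} (hg : ∀ j, (g j).coeff 0 ≠ 0) (j : Fin (n + 1)) :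
    (∑' k : Fin (n + 1) → ℕ, if b ^ m ≤ k j ∧ X ^ m ∣ dualPoly b g k then
      ENNReal.ofReal (∏ i : Fin (n + 1), coordWeight b α (γ i) (k i)) else 0) ≤
      ENNReal.ofReal (γ j * ((b : ℝ) ^ m) ^ (-α)) * decaySum b α *
        ∏ i : Fin (n + 1), (1 + ENNReal.ofReal (γ i) * decaySum b α) := by
  rw [← (Fin.insertNthEquiv (fun _ => ℕ) j).tsum_eq, ENNReal.tsum_prod', ENNReal.tsum_comm]
  have h1 : ∀ r : Fin n → ℕ, (∑' a : ℕ,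
      if b ^ m ≤ Fin.insertNthEquiv (fun _ => ℕ) j (a, r) j ∧
        X ^ m ∣ dualPoly b g (Fin.insertNthEquiv (fun _ => ℕ) j (a, r)) then
      ENNReal.ofReal (∏ i : Fin (n + 1),
        coordWeight b α (γ i) (Fin.insertNthEquiv (fun _ => ℕ) j (a, r) i)) else 0) ≤
      ENNReal.ofReal (γ j * ((b : ℝ) ^ m) ^ (-α)) * decaySum b α *
        ∏ i : Fin n, ENNReal.ofReal (coordWeight b α (γ (j.succAbove i)) (r i)) := by
    intro r
    refine le_trans (le_of_eq ?_) (mul_le_mul_left (tsum_coordWeight_large_le (hγ j) (hg j)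
      (∑ i : Fin n, natPoly b (r i) * g (j.succAbove i))) _)
    rw [← ENNReal.tsum_mul_right]
    refine tsum_congr fun a => ?_
    rw [ite_mul, zero_mul]
    refine if_congr ?_ ?_ rfl
    · simp [Fin.insertNthEquiv, dualPoly, Fin.sum_univ_succAbove _ j]
    · rw [Fin.prod_univ_succAbove _ j, ENNReal.ofReal_mul (coordWeight_nonneg (hγ _) _),
        ENNReal.ofReal_prod_of_nonneg fun i _ => coordWeight_nonneg (hγ _) _]
      simp [Fin.insertNthEquiv]
  refine (ENNReal.tsum_le_tsum h1).trans ?_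
  rw [ENNReal.tsum_mul_left, tsum_prod_fin fun (i : Fin n) a =>
    ENNReal.ofReal (coordWeight b α (γ (j.succAbove i)) a)]
  refine mul_le_mul_right ?_ _
  rw [Fin.prod_univ_succAbove _ j]
  simp_rw [tsum_coordWeight (b := b) (α := α) (hγ _)]
  exact le_mul_of_one_le_left zero_le le_self_add

/-- A union bound over the coordinate j that leaves the box. -/
lemma latticeError_le_box_add_tail {m n : ℕ} {α : ℝ} {γ : ℕ → ℝ} (hγ : ∀ j, 0 < γ j)
    {g : Fin (n + 1) → (ZMod b)[X]} (hg : ∀ j, (g j).coeff 0 ≠ 0) :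
    latticeError b m (n + 1) α γ g ≤
      ∑ k ∈ dualBox b m g, ENNReal.ofReal (∏ j : Fin (n + 1), coordWeight b α (γ j) (k j)) +
      ∑ j : Fin (n + 1), ENNReal.ofReal (γ j * ((b : ℝ) ^ m) ^ (-α)) * decaySum b α *
        ∏ i : Fin (n + 1), (1 + ENNReal.ofReal (γ i) * decaySum b α) := by
  classical
  refine (latticeError_le_tsum hγ g).trans ?_
  refine le_trans ?_ (add_le_add_right (Finset.sum_le_sum fun j _ =>
    tsum_large_coord_le (m := m) (α := α) (fun i => (hγ i).le) hg j) _)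
  have h1 : ∑ k ∈ dualBox b m g, ENNReal.ofReal (∏ j : Fin (n + 1), coordWeight b α (γ j) (k j)) =
      ∑' k : Fin (n + 1) → ℕ, if k ∈ dualBox b m g then
        ENNReal.ofReal (∏ j : Fin (n + 1), coordWeight b α (γ j) (k j)) else 0 := by
    rw [tsum_eq_sum fun k hk => if_neg hk]
    exact Finset.sum_congr rfl fun k hk => (if_pos hk).symm
  rw [h1, ← Summable.tsum_finsetSum fun _ _ => ENNReal.summable, ← ENNReal.tsum_add]
  refine ENNReal.tsum_le_tsum fun k => ?_
  by_cases hk : k ≠ 0 ∧ X ^ m ∣ dualPoly b g k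
  · rw [if_pos hk]
    by_cases hbox : k ∈ dualBox b m g
    · rw [if_pos hbox]; exact le_self_add
    · have : ∃ j, b ^ m ≤ k j := by
        by_contra! h
        exact hbox (Finset.mem_filter.mpr ⟨Fintype.mem_piFinset.mpr
          fun j => Finset.mem_range.mpr (h j), hk⟩)
      obtain ⟨j, hj⟩ := this
      refine le_trans ?_ le_add_self
      refine le_trans ?_ (Finset.single_le_sum (fun _ _ => zero_le) (Finset.mem_univ j))
      rw [if_pos ⟨hj, hk.2⟩]
  · rw [if_neg hk]; exact zero_le

/-- The constant in the bound for the contribution of the frequencies outside the box. -/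
def tailConst (b : ℕ) (α : ℝ) (γ : ℕ → ℝ) : ℝ :=
  (∑' j, γ j) * (decaySum b α).toReal * Real.exp ((∑' j, γ j) * (decaySum b α).toReal)

lemma tail_le_tailConst {α : ℝ} (hα : 1 < α) {γ : ℕ → ℝ} (hγ : ∀ j, 0 ≤ γ j) (hs : Summable γ)
    (m d : ℕ) :
    ∑ j : Fin d, ENNReal.ofReal (γ j * ((b : ℝ) ^ m) ^ (-α)) * decaySum b α *
        ∏ i : Fin d, (1 + ENNReal.ofReal (γ i) * decaySum b α) ≤
      ENNReal.ofReal (((b : ℝ) ^ m) ^ (-α) * tailConst b α γ) := by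
  set μ := (decaySum b α).toReal
  have hμ0 : 0 ≤ μ := ENNReal.toReal_nonneg
  have hμ : decaySum b α = ENNReal.ofReal μ := (ENNReal.ofReal_toReal (decaySum_lt_top hα).ne).symm
  have hN : 0 ≤ ((b : ℝ) ^ m) ^ (-α) := by positivity
  have hsum : ∑ j : Fin d, γ j ≤ ∑' j, γ j := by
    rw [Fin.sum_univ_eq_sum_range]
    exact hs.sum_le_tsum _ fun j _ => hγ j
  have hprod : ∏ i : Fin d, (1 + ENNReal.ofReal (γ i) * decaySum b α) =
      ENNReal.ofReal (∏ i : Fin d, (1 + γ i * μ)) := by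
    rw [ENNReal.ofReal_prod_of_nonneg fun i _ => by have := hγ i; positivity]
    refine Finset.prod_congr rfl fun i _ => ?_
    rw [hμ, ENNReal.ofReal_add zero_le_one (mul_nonneg (hγ i) hμ0), ENNReal.ofReal_one,
      ENNReal.ofReal_mul (hγ i)]
  rw [← Finset.sum_mul, ← Finset.sum_mul, hprod, hμ,
    ← ENNReal.ofReal_sum_of_nonneg fun (j : Fin d) _ => mul_nonneg (hγ j) hN,
    ← ENNReal.ofReal_mul (Finset.sum_nonneg fun (j : Fin d) _ => mul_nonneg (hγ j) hN),
    ← ENNReal.ofReal_mul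
      (mul_nonneg (Finset.sum_nonneg fun (j : Fin d) _ => mul_nonneg (hγ j) hN) hμ0), ← Finset.sum_mul]
  refine ENNReal.ofReal_le_ofReal ?_
  have hexp : ∏ i : Fin d, (1 + γ i * μ) ≤ Real.exp ((∑' j, γ j) * μ) := by
    refine (Real.prod_one_add_le_exp_sum _ fun i : Fin d => mul_nonneg (hγ i) hμ0).trans
      (Real.exp_le_exp.mpr ?_)
    rw [← Finset.sum_mul]
    exact mul_le_mul_of_nonneg_right hsum hμ0
  have hpos : 0 ≤ ∑ j : Fin d, γ j := Finset.sum_nonneg fun j _ => hγ j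
  rw [tailConst, show (∑ j : Fin d, γ j) * ((b : ℝ) ^ m) ^ (-α) * μ * ∏ i : Fin d, (1 + γ i * μ) =
    ((b : ℝ) ^ m) ^ (-α) * ((∑ j : Fin d, γ j) * μ * ∏ i : Fin d, (1 + γ i * μ)) by ring]
  refine mul_le_mul_of_nonneg_left (mul_le_mul (mul_le_mul_of_nonneg_right hsum hμ0) hexp
    (Finset.prod_nonneg fun i _ => by have := hγ i; positivity) ?_) hN
  exact mul_nonneg (hpos.trans hsum) hμ0

/-! ### From exponent 1 to exponent α -/

lemma sum_rpow_le_rpow_sum {ι : Type*} (s : Finset ι) {x : ι → ℝ} (hx : ∀ i ∈ s, 0 ≤ x i)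
    {α : ℝ} (hα : 1 ≤ α) : ∑ i ∈ s, x i ^ α ≤ (∑ i ∈ s, x i) ^ α := by
  have hmul : ∀ y : ℝ, 0 ≤ y → y ^ α = y * y ^ (α - 1) := fun y hy => by
    rw [← Real.rpow_one_add' hy (by linarith)]; congr 1; ring
  rw [hmul _ (Finset.sum_nonneg hx), Finset.sum_mul]
  refine Finset.sum_le_sum fun i hi => ?_
  rw [hmul _ (hx i hi)]
  exact mul_le_mul_of_nonneg_left (Real.rpow_le_rpow (hx i hi) (Finset.single_le_sum hx hi)
    (by linarith)) (hx i hi)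

lemma coordWeight_rpow {α c : ℝ} (hc : 0 ≤ c) (k : ℕ) :
    coordWeight b α (c ^ α) k = freqWeight b 1 c k ^ α := by
  have hb0 : (0 : ℝ) < b := by exact_mod_cast (Fact.out : b.Prime).pos
  rw [coordWeight, freqWeight]
  split_ifs
  · simp
  · rw [Real.div_rpow hc (by positivity), ← Real.rpow_natCast, ← Real.rpow_mul hb0.le,
      Real.rpow_neg hb0.le, mul_comm α, div_eq_mul_inv]

lemma summable_rpow {η : ℕ → ℝ} (hη : ∀ j, 0 ≤ η j) (hs : Summable η) {α : ℝ} (hα : 1 ≤ α) :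
    Summable fun j => η j ^ α := by
  refine Summable.of_nonneg_of_le (fun j => Real.rpow_nonneg (hη j) _) (fun j => ?_)
    (hs.mul_right ((∑' i, η i) ^ (α - 1)))
  rw [show α = 1 + (α - 1) by ring, Real.rpow_one_add' (hη j) (by linarith), add_sub_cancel_left]
  exact mul_le_mul_of_nonneg_left (Real.rpow_le_rpow (hη j) (hs.le_tsum j fun i _ => hη i)
    (by linarith)) (hη j)

/-- The worst-case error of the rules returned by the algorithm run with the weights `η`, in the
Walsh space with the weights `η ^ α`. -/
theorem exists_latticeError_le (b : ℕ) [Fact b.Prime] {η : ℕ → ℝ} (hη : ∀ j, 0 < η j)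
    (hs : Summable η) : ∃ c : ℝ → ℝ, (∀ δ, 0 < δ → 0 < c δ) ∧
      ∀ α : ℝ, 1 < α → ∃ A : ℝ, 0 ≤ A ∧ ∀ m d : ℕ, 1 ≤ m → 1 ≤ d → ∀ g : Fin d → (ZMod b)[X],
        IsCBCDBDOutput b m d η g → ∀ δ : ℝ, 0 < δ →
          latticeError b m d α (fun j => η j ^ α) g ≤
            ENNReal.ofReal (1 / ((b : ℝ) ^ m) ^ α * (A + (c δ * ((b : ℝ) ^ m) ^ δ) ^ α)) := by
  have hb0 : (0 : ℝ) < b := by exact_mod_cast (Fact.out : b.Prime).pos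
  choose! c hc hcb using fun δ (hδ : 0 < δ) => exists_sum_dualBox_le b hη hs hδ
  have hη' : ∀ j, 0 ≤ η j := fun j => (hη j).le
  refine ⟨c, hc, fun α hα => ⟨tailConst b α fun j => η j ^ α, ?_, ?_⟩⟩
  · have : 0 ≤ ∑' j, η j ^ α := tsum_nonneg fun j => Real.rpow_nonneg (hη' j) _
    rw [tailConst]
    positivity
  · intro m d hm hd g hg δ hδ
    obtain ⟨n, rfl⟩ : ∃ n, d = n + 1 := ⟨d - 1, by omega⟩
    have hN : (0 : ℝ) < (b : ℝ) ^ m := pow_pos hb0 m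
    refine (latticeError_le_box_add_tail (fun j => Real.rpow_pos_of_pos (hη j) α)
      fun j => by simp [coeff_zero_of_output hm hg j]).trans ?_
    rw [mul_add, add_comm, ENNReal.ofReal_add]
    · refine add_le_add ?_ ?_
      · rw [one_div, ← Real.rpow_neg hN.le]
        exact tail_le_tailConst hα (fun j => Real.rpow_nonneg (hη' j) _)
          (summable_rpow hη' hs hα.le) m (n + 1)
      · have hf : ∀ k ∈ dualBox b m g, 0 ≤ ∏ j : Fin (n + 1), freqWeight b 1 (η j) (k j) :=
          fun k _ => Finset.prod_nonneg fun j _ => freqWeight_nonneg zero_le_one (hη' j) _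
        rw [← ENNReal.ofReal_sum_of_nonneg fun k _ => Finset.prod_nonneg fun (j : Fin (n + 1)) _ =>
          coordWeight_nonneg (Real.rpow_nonneg (hη' j) _) _]
        refine ENNReal.ofReal_le_ofReal ?_
        simp_rw [coordWeight_rpow (b := b) (hη' _)]
        rw [Finset.sum_congr rfl fun k _ => Real.finsetProd_rpow _ _
          (fun (j : Fin (n + 1)) _ => freqWeight_nonneg zero_le_one (hη' j) _) α]
        refine (sum_rpow_le_rpow_sum _ hf hα.le).trans ?_
        refine (Real.rpow_le_rpow (Finset.sum_nonneg hf) (hcb δ hδ m (n + 1) hm g hg)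
          (by linarith)).trans (le_of_eq ?_)
        have := hc δ hδ
        rw [Real.mul_rpow (by positivity) (by positivity), Real.div_rpow zero_le_one hN.le,
          Real.one_rpow]
    · have : 0 ≤ ∑' j, η j ^ α := tsum_nonneg fun j => Real.rpow_nonneg (hη' j) _
      rw [tailConst]
      positivity
    · have := hc δ hδ
      positivity

end WalshPLR

end

/-! ### Separating the dependence on α and δ -/

theorem mainTheorem1 (b : ℕ) [Fact b.Prime] (γ : ℕ → ℝ) (hγ : ∀ j, 0 < γ j) :
    (Summable γ →
      ∃ C Cbar : ℝ → ℝ, (∀ α : ℝ, 1 < α → 0 < C α) ∧ (∀ δ : ℝ, 0 < δ → 0 < Cbar δ) ∧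
        ∀ m d : ℕ, 4 ≤ m → 1 ≤ d → ∀ g : Fin d → Polynomial (ZMod b),
          WalshPLR.IsCBCDBDOutput b m d γ g →
          ∀ δ : ℝ, 0 < δ → ∀ α : ℝ, 1 < α →
            WalshPLR.latticeError b m d α (fun j => γ j ^ α) g ≤
              ENNReal.ofReal (1 / ((b : ℝ) ^ m) ^ α *
                (C α + Cbar δ * ((b : ℝ) ^ m) ^ (α * δ)))) ∧
    (∃ K : ℝ, 0 < K ∧
      ∀ α : ℝ, 1 < α → Summable (fun j => γ j ^ (1 / α)) →
        ∃ Kbar : ℝ → ℝ, (∀ δ : ℝ, 0 < δ → 0 < Kbar δ) ∧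
          ∀ m d : ℕ, 4 ≤ m → 1 ≤ d → ∀ g : Fin d → Polynomial (ZMod b),
            WalshPLR.IsCBCDBDOutput b m d (fun j => γ j ^ (1 / α)) g →
            ∀ δ : ℝ, 0 < δ →
              WalshPLR.latticeError b m d α γ g ≤
                ENNReal.ofReal (1 / ((b : ℝ) ^ m) ^ α *
                  (K + Kbar δ * ((b : ℝ) ^ m) ^ (α * δ)))) := by
  have hb1 : (1 : ℝ) ≤ b := by exact_mod_cast (Fact.out : b.Prime).one_le
  have hN1 : ∀ m : ℕ, (1 : ℝ) ≤ (b : ℝ) ^ m := fun m => one_le_pow₀ hb1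
  constructor
  · intro hs
    obtain ⟨c, hc, h⟩ := WalshPLR.exists_latticeError_le b hγ hs
    choose! A hA hbound using h
    refine ⟨fun α => A α + c (1 / (2 * α)) ^ (2 * α) + 1, fun δ => max 1 (c (δ / 2)) ^ (2 / δ) + 1,
      fun α hα => ?_, fun δ _ => by positivity, fun m d hm hd g hg δ hδ α hα => ?_⟩
    · have := hA α hα
      have := hc (1 / (2 * α)) (by positivity)
      positivity
    · have hα0 : 0 < α := by linarith
      have hNpos : (0 : ℝ) < (b : ℝ) ^ m := zero_lt_one.trans_le (hN1 m)
      have hNδ : 1 ≤ ((b : ℝ) ^ m) ^ (α * δ) := Real.one_le_rpow (hN1 m) (by positivity)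
      -- The inequality x y ≤ x² + y² separates the constant from the power of N, at the price of
      -- doubling both exponents.
      have hsplit : ∀ ε, 0 < ε → (c ε * ((b : ℝ) ^ m) ^ ε) ^ α ≤
          c ε ^ (2 * α) + ((b : ℝ) ^ m) ^ (2 * (ε * α)) := by
        intro ε hε
        have hcε := hc ε hε
        have e1 : c ε ^ (2 * α) = (c ε ^ α) ^ 2 := by
          rw [← Real.rpow_two, ← Real.rpow_mul hcε.le, mul_comm]
        have e2 : ((b : ℝ) ^ m) ^ (2 * (ε * α)) = (((b : ℝ) ^ m) ^ (ε * α)) ^ 2 := by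
          rw [← Real.rpow_two (_ ^ (ε * α)), ← Real.rpow_mul hNpos.le, mul_comm]
        rw [Real.mul_rpow hcε.le (by positivity), ← Real.rpow_mul hNpos.le, e1, e2]
        nlinarith [sq_nonneg (c ε ^ α - ((b : ℝ) ^ m) ^ (ε * α)), sq_nonneg (c ε ^ α),
          sq_nonneg (((b : ℝ) ^ m) ^ (ε * α))]
      have hM : 0 ≤ max 1 (c (δ / 2)) ^ (2 / δ) := by positivity
      have hE : 0 ≤ c (1 / (2 * α)) ^ (2 * α) :=
        Real.rpow_nonneg (hc _ (by positivity)).le _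
      -- If α ≤ 1/δ, take ε = δ/2: c(ε)^(2α) is then bounded in terms of δ alone. If α > 1/δ, take ε
      -- = 1/(2α): the constant depends on α alone, and the remaining power N is at most N^(αδ).
      rcases le_or_gt α (1 / δ) with hle | hgt
      · refine (hbound α hα m d (by omega) hd g hg (δ / 2) (by positivity)).trans
          (ENNReal.ofReal_le_ofReal (mul_le_mul_of_nonneg_left ?_ (by positivity)))
        have h1 := hsplit (δ / 2) (by positivity)
        rw [show 2 * (δ / 2 * α) = α * δ by ring] at h1
        have h2 : c (δ / 2) ^ (2 * α) ≤ max 1 (c (δ / 2)) ^ (2 / δ) := by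
          refine (Real.rpow_le_rpow (hc _ (by positivity)).le (le_max_right 1 _)
            (by positivity)).trans (Real.rpow_le_rpow_of_exponent_le (le_max_left _ _) ?_)
          rw [show 2 / δ = 2 * (1 / δ) by ring]
          linarith
        nlinarith [mul_le_mul_of_nonneg_left hNδ hM]
      · refine (hbound α hα m d (by omega) hd g hg (1 / (2 * α)) (by positivity)).trans
          (ENNReal.ofReal_le_ofReal (mul_le_mul_of_nonneg_left ?_ (by positivity)))
        have h1 := hsplit (1 / (2 * α)) (by positivity)
        rw [show 2 * (1 / (2 * α) * α) = 1 by field_simp] at h1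
        have h2 : ((b : ℝ) ^ m) ^ (1 : ℝ) ≤ ((b : ℝ) ^ m) ^ (α * δ) := by
          refine Real.rpow_le_rpow_of_exponent_le (hN1 m) ?_
          rw [div_lt_iff₀ hδ] at hgt
          exact hgt.le
        nlinarith [mul_le_mul_of_nonneg_left hNδ hM]
  -- `Kbar` may depend on α and N^(αδ) ≥ 1, so it absorbs the tail constant, and any positive `K`
  -- serves.
  · refine ⟨1, one_pos, fun α hα hs => ?_⟩
    have hα0 : 0 < α := by linarith
    obtain ⟨c, hc, h⟩ := WalshPLR.exists_latticeError_le b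
      (fun j => Real.rpow_pos_of_pos (hγ j) (1 / α)) hs
    obtain ⟨A, hA, hbound⟩ := h α hα
    refine ⟨fun δ => A + c δ ^ α, fun δ hδ => ?_, fun m d hm hd g hg δ hδ => ?_⟩
    · have := hc δ hδ
      positivity
    · have hγα : (fun j => (γ j ^ (1 / α)) ^ α) = γ := by
        funext j
        rw [← Real.rpow_mul (hγ j).le, one_div_mul_cancel hα0.ne', Real.rpow_one]
      have hmain := hbound m d (by omega) hd g hg δ hδ
      rw [hγα] at hmain
      refine hmain.trans (ENNReal.ofReal_le_ofReal (mul_le_mul_of_nonneg_left ?_ (by positivity)))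
      have hNδ : 1 ≤ ((b : ℝ) ^ m) ^ (α * δ) := Real.one_le_rpow (hN1 m) (by positivity)
      rw [Real.mul_rpow (hc δ hδ).le (by positivity), ← Real.rpow_mul (by positivity),
        mul_comm δ α, add_mul]
      nlinarith [mul_le_mul_of_nonneg_left hNδ hA]
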